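/- \textbf{Theorem 4 (Generalized CGMT).} Let $k,d,n_1,\dots,n_k$ be natural numbers, let $S_w\subset\mathbb R^d$, $S_{v_1}\subset\mathbb R^{n_1},\dots,S_{v_k}\subset\mathbb R^{n_k}$ be nonempty compact convex sets, and put $S_v:=S_{v_1}\times\dots\times S_{v_k}$, with elements $v=(v_1,\dots,v_k)$. Let $\psi:S_w\times S_v\to\mathbb R$, $\alpha_\ell:\mathbb R^d\to\mathbb R^d$ and $\beta_\ell:\mathbb R^{n_\ell}\to\mathbb R^{n_\ell}$ ($\ell=1,\dots,k$) be continuous. Let $G=(G_1,\dots,G_k)$ with $G_\ell\in\mathbb R^{n_\ell\times d}$, and $g=(g_1,\dots,g_k)$, $h=(h_1,\dots,h_k)$ with $g_\ell\in\mathbb R^d$, $h_\ell\in\mathbb R^{n_\ell}$, be random, such that all the entries of $G_1,\dots,G_k$ are i.i.d. $\mathcal N(0,1)$ and all the entries of $g_1,\dots,g_k,h_1,\dots,h_k$ are i.i.d. $\mathcal N(0,1)$. With Euclidean norms, set $$F_G(w,v):=\sum_{\ell=1}^k\beta_\ell(v_\ell)^TG_\ell\,\alpha_\ell(w)+\psi(w,v),$$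 $$f_{g,h}(w,v):=\sum_{\ell=1}^k\Big[\|\beta_\ell(v_\ell)\|\,g_\ell^T\alpha_\ell(w)+\|\alpha_\ell(w)\|\,h_\ell^T\beta_\ell(v_\ell)\Big]+\psi(w,v),$$ and, for $C\subseteq S_w$, $$\Phi_C(G):=\min_{w\in C}\max_{v\in S_v}F_G(w,v),\qquad \phi_C(g,h):=\min_{w\in C}\max_{v\in S_v}f_{g,h}(w,v),$$ $\Phi:=\Phi_{S_w}$, $\phi:=\phi_{S_w}$ (a minimum over the empty set is $+\infty$). Then: (1) For every $t\in\mathbb R$, $\ \mathbb P(\Phi(G)<t)\le 2^k\,\mathbb P(\phi(g,h)<t)$. (2) Assume moreover that $\psi$ is convex in $w\in S_w$ and concave in $v\in S_v$, and that all $\alpha_\ell,\beta_\ell$ are affine, i.e. $\alpha_\ell(w)=A_\ell w+a_\ell$ and $\beta_\ell(u)=B_\ell u+b_\ell$ for some $A_\ell\in\mathbb R^{d\times d}$, $a_\ell\in\mathbb R^d$, $B_\ell\in\mathbb R^{n_\ell\times n_\ell}$, $b_\ell\in\mathbb R^{n_\ell}$. Then for all $c\in\mathbb R$ and $\eta>0$,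 $$\mathbb P(|\Phi(G)-c|>\eta)\le 2^k\,\mathbb P(|\phi(g,h)-c|>\eta).$$ (3) In the setting of (2), let $S$ be a (relatively) open subset of $S_w$ and $S^c:=S_w\setminus S$. Suppose that there are $\epsilon,\delta>0$ and $\bar\phi,\bar\phi_{S^c}\in\mathbb R$ with $\bar\phi_{S^c}\ge\bar\phi+3\delta$, $\ \mathbb P(\phi(g,h)<\bar\phi+\delta)\ge 1-\epsilon$ and $\mathbb P(\phi_{S^c}(g,h)>\bar\phi_{S^c}-\delta)\ge1-\epsilon$. Then, with probability at least $1-2^{k+1}\epsilon$, the set $\arg\min_{w\in S_w}\max_{v\in S_v}F_G(w,v)$ is nonempty and contained in $S$; in particular, for any choice $w_\Phi(G)$ of a minimizer, $\mathbb P(w_\Phi(G)\in S)\ge 1-2^{k+1}\epsilon$. -/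

import Mathlib

open MeasureTheory ProbabilityTheory

namespace GCGMT

/-- The common law assumption: the real random variables `X i` are i.i.d. `N(0,1)`. -/
def IsIIDStdGaussian {Ω ι : Type*} [MeasurableSpace Ω] (μ : Measure Ω) (X : ι → Ω → ℝ) : Prop :=
  (∀ i, HasLaw (X i) (gaussianReal 0 1) μ) ∧ iIndepFun X μ

/-- `max_{v ∈ T} F w v`, as a function of `w`. -/
noncomputable def maxOver {W V : Type*} (T : Set V) (F : W → V → ℝ) (w : W) : ℝ :=
  sSup ((fun v => F w v) '' T)

/-- `min_{w ∈ S} max_{v ∈ T} F w v`. -/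
noncomputable def minMax {W V : Type*} (S : Set W) (T : Set V) (F : W → V → ℝ) : ℝ :=
  sInf (maxOver T F '' S)

/-- The set `argmin_{w ∈ S} max_{v ∈ T} F w v` of all minimizers. -/
def argminMax {W V : Type*} (S : Set W) (T : Set V) (F : W → V → ℝ) : Set W :=
  {w | w ∈ S ∧ IsMinOn (maxOver T F) S w}

section Objectives

variable {d k : ℕ} {n : Fin k → ℕ}
  (α : Fin k → EuclideanSpace ℝ (Fin d) → EuclideanSpace ℝ (Fin d))
  (β : (l : Fin k) → EuclideanSpace ℝ (Fin (n l)) → EuclideanSpace ℝ (Fin (n l)))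
  (ψ : EuclideanSpace ℝ (Fin d) → ((l : Fin k) → EuclideanSpace ℝ (Fin (n l))) → ℝ)

open Matrix in
/-- The primary objective `∑ₗ βₗ(vₗ)ᵀ Gₗ αₗ(w) + ψ(w, v)`. -/
noncomputable def primaryObj (G : (l : Fin k) → Matrix (Fin (n l)) (Fin d) ℝ)
    (w : EuclideanSpace ℝ (Fin d)) (v : (l : Fin k) → EuclideanSpace ℝ (Fin (n l))) : ℝ :=
  ∑ l, (β l (v l)).ofLp ⬝ᵥ (G l *ᵥ (α l w).ofLp) + ψ w v

open Matrix in
/-- The auxiliary objective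
`∑ₗ (‖βₗ(vₗ)‖ gₗᵀ αₗ(w) + ‖αₗ(w)‖ hₗᵀ βₗ(vₗ)) + ψ(w, v)`, with Euclidean norms. -/
noncomputable def auxObj (g : Fin k → Fin d → ℝ) (h : (l : Fin k) → Fin (n l) → ℝ)
    (w : EuclideanSpace ℝ (Fin d)) (v : (l : Fin k) → EuclideanSpace ℝ (Fin (n l))) : ℝ :=
  ∑ l, (‖β l (v l)‖ * (g l ⬝ᵥ (α l w).ofLp) + ‖α l w‖ * (h l ⬝ᵥ (β l (v l)).ofLp)) + ψ w v

end Objectives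

open Matrix in
/-- `f` is affine: `f x = A x + a` for a matrix `A` and a vector `a`. -/
def IsAffine {m : ℕ} (f : EuclideanSpace ℝ (Fin m) → EuclideanSpace ℝ (Fin m)) : Prop :=
  ∃ (A : Matrix (Fin m) (Fin m) ℝ) (a : EuclideanSpace ℝ (Fin m)),
    ∀ x, f x = WithLp.toLp 2 (A *ᵥ x.ofLp) + a

/-- `ψ` is convex in its first argument and concave in its second one on `S × T`. -/
def IsConvexConcaveOn {W V : Type*} [AddCommGroup W] [Module ℝ W] [AddCommGroup V] [Module ℝ V]
    (S : Set W) (T : Set V) (ψ : W → V → ℝ) : Prop :=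
  (∀ v ∈ T, ConvexOn ℝ S (fun w => ψ w v)) ∧ (∀ w ∈ S, ConcaveOn ℝ T (fun v => ψ w v))

end GCGMT

/-! The engine is Gordon's comparison inequality: if two centred Gaussian families indexed by pairs
(w, v) have equal covariances whenever w = w', and the covariances of X dominate those of Y
otherwise, then the lower tail of min-max X is at most that of min-max Y. Take Y to be the auxiliary
process and X the bilinear process plus `∑ₗ ‖αₗ(w)‖ ‖βₗ(vₗ)‖ γₗ` with independent standard normal
γₗ. The covariance gap is a sum over l of `(‖α‖‖α'‖ - ⟨α, α'⟩) (‖β‖‖β'‖ - ⟨β, β'⟩)`, nonnegative by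
Cauchy–Schwarz and zero when w = w'. With probability at least `2⁻ᵏ`, and independently of G, all γₗ
are nonpositive, and then X lies below the primary process; this costs the factor `2ᵏ` and gives (1)
(`gaussian_minMax`).

Gordon's inequality (`gordon_comparison`) is proved by rotating Y into X. Gaussian integration by
parts makes the derivative of the expectation a sum of covariance gaps times second derivatives of a
smoothed indicator, whose mixed derivatives across different rows are nonnegative. Countable dense
sets extend the result to compact index sets (`gordon_comparison_compact`).

For the upper tail, the primary objective is convex-concave, so Sion's theorem exchanges min and
max; the lower-tail bound applied to the negated problem with the players swapped, followed by weak
duality on the auxiliary side, gives the claim. Adding the two tails gives (2). For (3), a minimizer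
outside S forces either a large optimal value on all of `Sw` or a small one on the complement of S;
each event has probability at most `2ᵏ ε`. -/

namespace GCGMT

/-! ### Gaussian integration by parts. -/

section Stein

/-- The density p satisfies `p' = -x p`, so this is ordinary integration by parts; boundedness of f
and f' supplies the integrability that removes boundary terms. -/
lemma integral_mul_gaussianReal_eq {f f' : ℝ → ℝ} {C : ℝ} (hf : ∀ x, HasDerivAt f (f' x) x)
    (hf' : Continuous f') (hC : ∀ x, |f x| ≤ C) (hC' : ∀ x, |f' x| ≤ C) :
    ∫ x, x * f x ∂(gaussianReal 0 1) = ∫ x, f' x ∂(gaussianReal 0 1) := by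
  have hpdf : gaussianPDFReal 0 1 = fun x => (√(2 * Real.pi))⁻¹ * Real.exp (-(1 / 2) * x ^ 2) := by
    ext x
    simp only [gaussianPDFReal, NNReal.coe_one, mul_one, sub_zero]
    congr 2
    ring
  have hcont : Continuous f := continuous_iff_continuousAt.2 fun x => (hf x).continuousAt
  have hder : ∀ x, HasDerivAt (gaussianPDFReal 0 1) (-(x * gaussianPDFReal 0 1 x)) x := by
    intro x
    rw [hpdf]
    have h1 : HasDerivAt (fun x : ℝ => -(1 / 2) * x ^ 2) (-x) x := by
      simpa using ((hasDerivAt_pow 2 x).const_mul (-(1 / 2) : ℝ)).congr_deriv (by push_cast; ring)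
    exact (h1.exp.const_mul _).congr_deriv (by ring)
  have hint : Integrable (gaussianPDFReal 0 1) := integrable_gaussianPDFReal 0 1
  have hint' : Integrable fun x => -(x * gaussianPDFReal 0 1 x) := by
    rw [hpdf]
    refine Integrable.neg ?_
    refine ((integrable_mul_exp_neg_mul_sq (b := 1 / 2) (by norm_num)).const_mul
      (√(2 * Real.pi))⁻¹).congr (ae_of_all _ fun x => ?_)
    simp only
    ring
  rw [integral_gaussianReal_eq_integral_smul one_ne_zero,
    integral_gaussianReal_eq_integral_smul one_ne_zero]
  have key := integral_mul_deriv_eq_deriv_mul_of_integrable (u := f) (u' := f')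
    (v := gaussianPDFReal 0 1) (v' := fun x => -(x * gaussianPDFReal 0 1 x))
    (fun x _ => hf x) (fun x _ => hder x)
    (hint'.bdd_mul hcont.aestronglyMeasurable (ae_of_all _ hC))
    (hint.bdd_mul hf'.aestronglyMeasurable (ae_of_all _ hC'))
    (hint.bdd_mul hcont.aestronglyMeasurable (ae_of_all _ hC))
  simp only [mul_neg, integral_neg, neg_inj] at key
  calc _ = ∫ x, f x * (x * gaussianPDFReal 0 1 x) := by
        refine integral_congr_ae (ae_of_all _ fun x => ?_); simp only [smul_eq_mul]; ring
    _ = _ := key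
    _ = _ := by refine integral_congr_ae (ae_of_all _ fun x => ?_); simp only [smul_eq_mul]; ring

variable {ι : Type*} [Fintype ι]

/-- The standard Gaussian measure on `ι → ℝ`. -/
noncomputable abbrev stdGauss (ι : Type*) [Fintype ι] : Measure (ι → ℝ) :=
  Measure.pi fun _ => gaussianReal 0 1

/-- Resampling one coordinate independently preserves the product law. This lets the one-dimensional
formula act on coordinate c without splitting the index type. -/
lemma measurePreserving_update [DecidableEq ι] (c : ι) :
    MeasurePreserving (fun p : (ι → ℝ) × ℝ => Function.update p.1 c p.2)
      ((stdGauss ι).prod (gaussianReal 0 1)) (stdGauss ι) := by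
  have hm : Measurable fun p : (ι → ℝ) × ℝ => Function.update p.1 c p.2 := by
    refine measurable_pi_lambda _ fun i => ?_
    by_cases h : i = c
    · subst h; simpa using measurable_snd
    · simp only [Function.update_of_ne h]; fun_prop
  refine ⟨hm, ?_⟩
  refine (Measure.pi_eq fun s hs => ?_).symm
  rw [Measure.map_apply hm (MeasurableSet.univ_pi hs)]
  have : (fun p : (ι → ℝ) × ℝ => Function.update p.1 c p.2) ⁻¹' (Set.univ.pi s)
      = (Set.univ.pi (Function.update s c Set.univ)) ×ˢ s c := by
    ext ⟨x, y⟩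
    simp only [Set.mem_preimage, Set.mem_pi, Set.mem_univ, true_imp_iff, Set.mem_prod]
    constructor
    · intro h
      refine ⟨fun i => ?_, by simpa using h c⟩
      by_cases hi : i = c
      · subst hi; simp
      · simpa [hi] using h i
    · rintro ⟨h, hc⟩ i
      by_cases hi : i = c
      · subst hi; simpa using hc
      · simpa [hi] using h i
  rw [this, Measure.prod_prod, Measure.pi_pi, ← Finset.mul_prod_erase _ _ (Finset.mem_univ c),
    ← Finset.mul_prod_erase Finset.univ (fun i => (gaussianReal 0 1) (s i)) (Finset.mem_univ c)]
  simp only [Function.update_self, measure_univ, one_mul]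
  rw [mul_comm]
  congr 1
  refine Finset.prod_congr rfl fun i hi => ?_
  rw [Function.update_of_ne (Finset.ne_of_mem_erase hi)]

lemma integrable_eval_stdGauss (c : ι) : Integrable (fun x : ι → ℝ => x c) (stdGauss ι) := by
  have h : Integrable (fun x : ℝ => x) (gaussianReal 0 1) :=
    memLp_one_iff_integrable.1 (memLp_id_gaussianReal 1)
  exact (measurePreserving_eval (fun _ : ι => gaussianReal 0 1) c).integrable_comp_of_integrable h

lemma integrable_norm_stdGauss : Integrable (fun x : ι → ℝ => ‖x‖) (stdGauss ι) := by
  refine Integrable.mono' (g := fun x : ι → ℝ => ∑ c, |x c|)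
    (integrable_finsetSum _ fun c _ => (integrable_eval_stdGauss c).abs)
    continuous_norm.aestronglyMeasurable (ae_of_all _ fun x => ?_)
  rw [norm_norm, pi_norm_le_iff_of_nonneg (Finset.sum_nonneg fun _ _ => abs_nonneg _)]
  exact fun i => Finset.single_le_sum (f := fun c => |x c|) (fun _ _ => abs_nonneg _)
    (Finset.mem_univ i)

/-- Gaussian integration by parts. -/
lemma integral_eval_mul_stdGauss [DecidableEq ι] (c : ι) {f f' : (ι → ℝ) → ℝ} {C : ℝ}
    (hf : ∀ x, HasDerivAt (fun s => f (Function.update x c s)) (f' x) (x c))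
    (hfc : Continuous f) (hfc' : Continuous f') (hC : ∀ x, |f x| ≤ C) (hC' : ∀ x, |f' x| ≤ C) :
    ∫ x, x c * f x ∂(stdGauss ι) = ∫ x, f' x ∂(stdGauss ι) := by
  have key : ∀ g : (ι → ℝ) → ℝ, Integrable g (stdGauss ι) →
      ∫ x, g x ∂(stdGauss ι)
        = ∫ x, ∫ s, g (Function.update x c s) ∂(gaussianReal 0 1) ∂(stdGauss ι) := by
    intro g hg
    have hmp := measurePreserving_update (ι := ι) c
    have hg' := hmp.integrable_comp_of_integrable hg
    refine Eq.trans ?_ (integral_prod _ hg')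
    conv_lhs => rw [← hmp.map_eq]
    refine integral_map hmp.measurable.aemeasurable ?_
    rw [hmp.map_eq]
    exact hg.aestronglyMeasurable
  rw [key _ ((integrable_eval_stdGauss c).mul_bdd hfc.aestronglyMeasurable (ae_of_all _ hC)),
    key _ (Integrable.of_bound hfc'.aestronglyMeasurable C (ae_of_all _ hC'))]
  refine integral_congr_ae (ae_of_all _ fun x => ?_)
  simp only [Function.update_self]
  refine integral_mul_gaussianReal_eq (C := C) (fun s => ?_) ?_ (fun s => hC _) (fun s => hC' _)
  · simpa using hf (Function.update x c s)
  · exact hfc'.comp (continuous_const.update c continuous_id)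

end Stein

/-! ### Interpolation between two Gaussian vectors. -/

section Interpolation

variable {ι κ : Type*} [Fintype ι] [Fintype κ]

/-- Smooth functions all of whose derivatives are bounded. -/
structure IsBoundedSmooth {E : Type*} [NormedAddCommGroup E] [NormedSpace ℝ E] (F : E → ℝ) :
    Prop where
  contDiff : ContDiff ℝ (⊤ : ℕ∞) F
  bounded : ∀ m : ℕ, ∃ C, ∀ x, ‖iteratedFDeriv ℝ m F x‖ ≤ C

lemma IsBoundedSmooth.exists_bound {E : Type*} [NormedAddCommGroup E] [NormedSpace ℝ E]
    {F : E → ℝ} (hF : IsBoundedSmooth F) : ∃ C, 0 ≤ C ∧ ∀ x, |F x| ≤ C ∧ ‖fderiv ℝ F x‖ ≤ C ∧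
      ‖fderiv ℝ (fderiv ℝ F) x‖ ≤ C := by
  obtain ⟨C0, h0⟩ := hF.bounded 0
  obtain ⟨C1, h1⟩ := hF.bounded 1
  obtain ⟨C2, h2⟩ := hF.bounded 2
  simp only [norm_iteratedFDeriv_zero] at h0
  simp only [norm_iteratedFDeriv_one] at h1
  have h2' : ∀ x, ‖fderiv ℝ (fderiv ℝ F) x‖ ≤ C2 := fun x => by
    rw [← norm_iteratedFDeriv_one, norm_iteratedFDeriv_fderiv]; exact h2 x
  refine ⟨max C0 (max C1 C2), ?_, fun x => ⟨?_, ?_, ?_⟩⟩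
  · exact le_max_of_le_left ((norm_nonneg _).trans (h0 0))
  · exact le_max_of_le_left (h0 x)
  · exact le_max_of_le_right (le_max_of_le_left (h1 x))
  · exact le_max_of_le_right (le_max_of_le_right (h2' x))

/-- If the covariance of `X` minus that of `Y` has entrywise the same sign as the Hessian of `F`,
and `X`, `Y` are uncorrelated linear images of a standard Gaussian vector, then
`𝔼 F(Y) ≤ 𝔼 F(X)`. -/
theorem integral_comp_le_of_covariance [DecidableEq ι] [DecidableEq κ]
    (X Y : (ι → ℝ) →L[ℝ] (κ → ℝ)) {F : (κ → ℝ) → ℝ} (hF : IsBoundedSmooth F)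
    (hXY : ∀ a b, ∑ c, X (Pi.single c 1) a * Y (Pi.single c 1) b = 0)
    (hD : ∀ x a b, 0 ≤ (∑ c, X (Pi.single c 1) a * X (Pi.single c 1) b
        - ∑ c, Y (Pi.single c 1) a * Y (Pi.single c 1) b)
      * fderiv ℝ (fderiv ℝ F) x (Pi.single a 1) (Pi.single b 1)) :
    ∫ x, F (Y x) ∂(stdGauss ι) ≤ ∫ x, F (X x) ∂(stdGauss ι) := by
  obtain ⟨C, hC0, hC⟩ := hF.exists_bound
  have hFd : Differentiable ℝ F := hF.contDiff.differentiable (by simp)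
  have hF2 : ContDiff ℝ 1 (fderiv ℝ F) := hF.contDiff.fderiv_right (by norm_cast)
  have hFdd : Differentiable ℝ (fderiv ℝ F) := hF2.differentiable (by simp)
  have hcF' : Continuous (fderiv ℝ F) := hF2.continuous
  have hcF'' : Continuous (fderiv ℝ (fderiv ℝ F)) := hF2.continuous_fderiv (by simp)
  -- A rotation from Y at 0 to X at π/2; unlike the path with square-root weights, it is
  -- differentiable at both endpoints.
  let Z : ℝ → (ι → ℝ) →L[ℝ] (κ → ℝ) := fun θ => Real.cos θ • Y + Real.sin θ • X
  let Z' : ℝ → (ι → ℝ) →L[ℝ] (κ → ℝ) := fun θ => -Real.sin θ • Y + Real.cos θ • X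
  have hZ : ∀ θ x, HasDerivAt (fun t => Z t x) (Z' θ x) θ := by
    intro θ x
    simp only [Z, Z', _root_.add_apply, _root_.smul_apply]
    exact ((Real.hasDerivAt_cos θ).smul_const (Y x)).add ((Real.hasDerivAt_sin θ).smul_const (X x))
  have hZ'norm : ∀ θ x, ‖Z' θ x‖ ≤ (‖Y‖ + ‖X‖) * ‖x‖ := by
    intro θ x
    refine ((Z' θ).le_opNorm x).trans (mul_le_mul_of_nonneg_right ?_ (norm_nonneg _))
    refine (norm_add_le _ _).trans (add_le_add ?_ ?_)
    · rw [norm_smul, norm_neg]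
      exact mul_le_of_le_one_left (norm_nonneg _) (Real.abs_sin_le_one θ)
    · rw [norm_smul]
      exact mul_le_of_le_one_left (norm_nonneg _) (Real.abs_cos_le_one θ)
  have hder : ∀ θ, HasDerivAt (fun t => ∫ x, F (Z t x) ∂(stdGauss ι))
      (∫ x, fderiv ℝ F (Z θ x) (Z' θ x) ∂(stdGauss ι)) θ := by
    intro θ
    refine (hasDerivAt_integral_of_dominated_loc_of_deriv_le (s := Set.univ)
      (F := fun t x => F (Z t x)) (F' := fun t x => fderiv ℝ F (Z t x) (Z' t x))
      (bound := fun x => C * ((‖Y‖ + ‖X‖) * ‖x‖)) Filter.univ_mem ?_ ?_ ?_ ?_ ?_ ?_).2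
    · exact Filter.Eventually.of_forall fun t =>
        (hFd.continuous.comp (Z t).continuous).aestronglyMeasurable
    · exact Integrable.of_bound (hFd.continuous.comp (Z θ).continuous).aestronglyMeasurable C
        (ae_of_all _ fun x => (hC _).1)
    · exact ((hcF'.comp (Z θ).continuous).clm_apply (Z' θ).continuous).aestronglyMeasurable
    · refine ae_of_all _ fun x t _ => ?_
      refine (ContinuousLinearMap.le_opNorm _ _).trans ?_
      exact mul_le_mul (hC _).2.1 (hZ'norm t x) (norm_nonneg _) hC0
    · exact (integrable_norm_stdGauss.const_mul _).const_mul _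
    · refine ae_of_all _ fun x t _ => ?_
      exact (hFd (Z t x)).hasFDerivAt.comp_hasDerivAt t (hZ t x)
  -- Expanding `Z' θ x` in coordinates leaves one factor `x c` per term; integration by parts trades
  -- it for a further derivative of F.
  have hstein : ∀ θ, ∫ x, fderiv ℝ F (Z θ x) (Z' θ x) ∂(stdGauss ι)
      = ∫ x, ∑ c, fderiv ℝ (fderiv ℝ F) (Z θ x) (Z θ (Pi.single c 1)) (Z' θ (Pi.single c 1))
        ∂(stdGauss ι) := by
    intro θ
    have hexp : ∀ x, fderiv ℝ F (Z θ x) (Z' θ x)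
        = ∑ c, x c * fderiv ℝ F (Z θ x) (Z' θ (Pi.single c 1)) := by
      intro x
      have hx : x = ∑ c, x c • (Pi.single c 1 : ι → ℝ) := by
        conv_lhs => rw [← Finset.univ_sum_single x]
        refine Finset.sum_congr rfl fun c _ => ?_
        rw [← Pi.single_smul]; simp
      conv_lhs => rw [show Z' θ x = Z' θ (∑ c, x c • (Pi.single c 1 : ι → ℝ)) by rw [← hx]]
      simp only [map_sum, map_smul, smul_eq_mul]
    have hf1 : ∀ w x, |fderiv ℝ F (Z θ x) w| ≤ C * ‖w‖ := fun w x =>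
      (ContinuousLinearMap.le_opNorm _ _).trans
        (mul_le_mul_of_nonneg_right (hC _).2.1 (norm_nonneg _))
    have hf2 : ∀ u w x, |fderiv ℝ (fderiv ℝ F) (Z θ x) u w| ≤ C * ‖u‖ * ‖w‖ := by
      intro u w x
      refine (ContinuousLinearMap.le_opNorm₂ (fderiv ℝ (fderiv ℝ F) (Z θ x)) u w).trans ?_
      have := (hC (Z θ x)).2.2
      gcongr
    have hc1 : ∀ w, Continuous fun x => fderiv ℝ F (Z θ x) w := fun w =>
      (hcF'.comp (Z θ).continuous).clm_apply continuous_const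
    have hc2 : ∀ u w, Continuous fun x => fderiv ℝ (fderiv ℝ F) (Z θ x) u w := fun u w =>
      ((hcF''.comp (Z θ).continuous).clm_apply continuous_const).clm_apply continuous_const
    simp_rw [hexp]
    rw [integral_finsetSum, integral_finsetSum]
    · refine Finset.sum_congr rfl fun c _ => ?_
      refine integral_eval_mul_stdGauss c
        (C := max (C * ‖Z' θ (Pi.single c 1)‖) (C * ‖Z θ (Pi.single c 1)‖ * ‖Z' θ (Pi.single c 1)‖))
        (fun x => ?_) (hc1 _) (hc2 _ _) (fun x => (hf1 _ x).trans (le_max_left _ _))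
        (fun x => (hf2 _ _ x).trans (le_max_right _ _))
      have h1 : HasDerivAt (fun s => Z θ (Function.update x c s)) (Z θ (Pi.single c 1)) (x c) :=
        (Z θ).hasFDerivAt.comp_hasDerivAt (x c) (hasDerivAt_update x c (x c))
      have h2 := (hFdd (Z θ x)).hasFDerivAt
      have h3 : HasDerivAt (fun s => fderiv ℝ F (Z θ (Function.update x c s)))
          (fderiv ℝ (fderiv ℝ F) (Z θ x) (Z θ (Pi.single c 1))) (x c) := by
        refine HasFDerivAt.comp_hasDerivAt (x c) ?_ h1
        simpa using h2
      have h4 := h3.clm_apply (hasDerivAt_const (x c) (Z' θ (Pi.single c 1)))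
      simpa using h4
    · exact fun c _ => Integrable.of_bound (hc2 _ _).aestronglyMeasurable _
        (ae_of_all _ fun x => hf2 _ _ x)
    · exact fun c _ => (integrable_eval_stdGauss c).mul_bdd (hc1 _).aestronglyMeasurable
        (ae_of_all _ fun x => hf1 _ x)
  have hnonneg : ∀ θ ∈ Set.Ioo 0 (Real.pi / 2), 0 ≤ ∫ x, fderiv ℝ F (Z θ x) (Z' θ x)
      ∂(stdGauss ι) := by
    intro θ hθ
    rw [hstein]
    refine integral_nonneg fun x => ?_
    simp only [Pi.zero_apply]
    have hs : 0 ≤ Real.sin θ * Real.cos θ := mul_nonneg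
      (Real.sin_nonneg_of_nonneg_of_le_pi hθ.1.le (by linarith [hθ.2, Real.pi_pos]))
      (Real.cos_nonneg_of_neg_pi_div_two_le_of_le (by linarith [hθ.1, Real.pi_pos]) hθ.2.le)
    have hexp : ∀ u w : κ → ℝ, fderiv ℝ (fderiv ℝ F) (Z θ x) u w
        = ∑ a, ∑ b, u a * w b *
          fderiv ℝ (fderiv ℝ F) (Z θ x) (Pi.single a 1) (Pi.single b 1) := by
      intro u w
      have hx : ∀ u : κ → ℝ, u = ∑ c, u c • (Pi.single c 1 : κ → ℝ) := by
        intro u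
        conv_lhs => rw [← Finset.univ_sum_single u]
        refine Finset.sum_congr rfl fun c _ => ?_
        rw [← Pi.single_smul]; simp
      conv_lhs => rw [hx u, hx w]
      simp only [map_sum, map_smul, smul_eq_mul, _root_.sum_apply,
        _root_.smul_apply, Finset.mul_sum, mul_assoc]
      rw [Finset.sum_comm]
      refine Finset.sum_congr rfl fun a _ => Finset.sum_congr rfl fun b _ => by ring
    rw [Finset.sum_congr rfl fun c _ => hexp _ _, Finset.sum_comm]
    refine Finset.sum_nonneg fun a _ => ?_
    rw [Finset.sum_comm]
    refine Finset.sum_nonneg fun b _ => ?_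
    rw [← Finset.sum_mul]
    -- The `cos²` and `sin²` terms are cross-covariances of X and Y, hence vanish; only the gap of
    -- the two covariances survives.
    have hcov : ∑ c, Z θ (Pi.single c 1) a * Z' θ (Pi.single c 1) b
        = (Real.sin θ * Real.cos θ) * (∑ c, X (Pi.single c 1) a * X (Pi.single c 1) b
        - ∑ c, Y (Pi.single c 1) a * Y (Pi.single c 1) b) := by
      have h1 := hXY a b
      have h2 := hXY b a
      calc _ = ∑ c, ((Real.sin θ * Real.cos θ) * (X (Pi.single c 1) a * X (Pi.single c 1) b)
            - (Real.sin θ * Real.cos θ) * (Y (Pi.single c 1) a * Y (Pi.single c 1) b)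
            + (Real.cos θ ^ 2) * (X (Pi.single c 1) b * Y (Pi.single c 1) a)
            - (Real.sin θ ^ 2) * (X (Pi.single c 1) a * Y (Pi.single c 1) b)) := by
            refine Finset.sum_congr rfl fun c _ => ?_
            simp only [Z, Z', _root_.add_apply, _root_.smul_apply,
              Pi.add_apply, Pi.smul_apply, smul_eq_mul]
            ring
        _ = _ := by
            rw [Finset.sum_sub_distrib, Finset.sum_add_distrib, Finset.sum_sub_distrib]
            simp only [← Finset.mul_sum, h1, h2]
            ring
    rw [hcov, mul_assoc]
    exact mul_nonneg hs (hD _ a b)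
  have hmono := monotoneOn_of_deriv_nonneg (convex_Icc 0 (Real.pi / 2))
    (f := fun t => ∫ x, F (Z t x) ∂(stdGauss ι))
    (fun θ _ => (hder θ).continuousAt.continuousWithinAt)
    (fun θ _ => (hder θ).differentiableAt.differentiableWithinAt)
    (fun θ hθ => by rw [(hder θ).deriv]; rw [interior_Icc] at hθ; exact hnonneg θ hθ)
  have := hmono (Set.left_mem_Icc.2 (by positivity)) (Set.right_mem_Icc.2 (by positivity))
    (by positivity : (0:ℝ) ≤ Real.pi / 2)
  simpa [Z] using this

end Interpolation


/-! ### Smooth cutoffs and the sign of mixed second derivatives. -/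

section BoundedSmooth

variable {E : Type*} [NormedAddCommGroup E] [NormedSpace ℝ E]

lemma IsBoundedSmooth.const (c : ℝ) : IsBoundedSmooth (fun _ : E => c) := by
  refine ⟨contDiff_const, fun m => ?_⟩
  rcases m with _ | m
  · exact ⟨|c|, fun x => by simp⟩
  · exact ⟨0, fun x => by simp [iteratedFDeriv_const_of_ne]⟩

lemma IsBoundedSmooth.sub {f g : E → ℝ} (hf : IsBoundedSmooth f) (hg : IsBoundedSmooth g) :
    IsBoundedSmooth (fun x => f x - g x) := by
  refine ⟨hf.contDiff.sub hg.contDiff, fun m => ?_⟩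
  obtain ⟨C, hC⟩ := hf.bounded m
  obtain ⟨D, hD⟩ := hg.bounded m
  refine ⟨C + D, fun x => ?_⟩
  have : iteratedFDeriv ℝ m (fun x => f x - g x) x
      = iteratedFDeriv ℝ m f x - iteratedFDeriv ℝ m g x :=
    iteratedFDeriv_sub_apply (hf.contDiff.of_le (by exact_mod_cast le_top)).contDiffAt
      (hg.contDiff.of_le (by exact_mod_cast le_top)).contDiffAt
  rw [this]
  exact (norm_sub_le _ _).trans (add_le_add (hC x) (hD x))

lemma IsBoundedSmooth.mul {f g : E → ℝ} (hf : IsBoundedSmooth f) (hg : IsBoundedSmooth g) :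
    IsBoundedSmooth (fun x => f x * g x) := by
  refine ⟨hf.contDiff.mul hg.contDiff, fun m => ?_⟩
  choose C hC using hf.bounded
  choose D hD using hg.bounded
  refine ⟨∑ i ∈ Finset.range (m + 1), (m.choose i : ℝ) * C i * D (m - i), fun x => ?_⟩
  refine (norm_iteratedFDeriv_mul_le hf.contDiff hg.contDiff x (by exact_mod_cast le_top)).trans ?_
  refine Finset.sum_le_sum fun i _ => ?_
  have := hC i x
  have := hD (m - i) x
  have : 0 ≤ C i := (norm_nonneg _).trans (hC i x)
  gcongr

lemma IsBoundedSmooth.prod {ι : Type*} (s : Finset ι) {f : ι → E → ℝ}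
    (hf : ∀ i, IsBoundedSmooth (f i)) : IsBoundedSmooth (fun x => ∏ i ∈ s, f i x) := by
  classical
  induction s using Finset.induction_on with
  | empty => simpa using IsBoundedSmooth.const (E := E) 1
  | insert i s hi ih => simpa only [Finset.prod_insert hi] using (hf i).mul ih

lemma IsBoundedSmooth.comp_clm {G : Type*} [NormedAddCommGroup G] [NormedSpace ℝ G] {f : E → ℝ}
    (hf : IsBoundedSmooth f) (L : G →L[ℝ] E) : IsBoundedSmooth (fun x => f (L x)) := by
  refine ⟨hf.contDiff.comp L.contDiff, fun m => ?_⟩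
  obtain ⟨C, hC⟩ := hf.bounded m
  refine ⟨C * ∏ _i : Fin m, ‖L‖, fun x => ?_⟩
  have : iteratedFDeriv ℝ m (fun x => f (L x)) x
      = (iteratedFDeriv ℝ m f (L x)).compContinuousLinearMap fun _ => L :=
    L.iteratedFDeriv_comp_right hf.contDiff x (by exact_mod_cast le_top)
  rw [this]
  refine (ContinuousMultilinearMap.norm_compContinuousLinearMap_le _ _).trans ?_
  exact mul_le_mul_of_nonneg_right (hC _) (Finset.prod_nonneg fun _ _ => norm_nonneg _)

/-- A smooth antitone function equal to `1` on `(-∞, l]` and to `0` on `[u, ∞)`. -/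
noncomputable def cutoff (l u x : ℝ) : ℝ := Real.smoothTransition ((u - x) / (u - l))

lemma cutoff_nonneg (l u x : ℝ) : 0 ≤ cutoff l u x := Real.smoothTransition.nonneg _

lemma cutoff_le_one (l u x : ℝ) : cutoff l u x ≤ 1 := Real.smoothTransition.le_one _

lemma cutoff_of_le {l u x : ℝ} (h : l < u) (hx : x ≤ l) : cutoff l u x = 1 :=
  Real.smoothTransition.one_of_one_le ((one_le_div (by linarith)).2 (by linarith))

lemma cutoff_of_ge {l u x : ℝ} (h : l < u) (hx : u ≤ x) : cutoff l u x = 0 :=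
  Real.smoothTransition.zero_of_nonpos (div_nonpos_of_nonpos_of_nonneg (by linarith) (by linarith))

lemma cutoff_antitone {l u : ℝ} (h : l < u) : Antitone (cutoff l u) := fun x y hxy =>
  Real.smoothTransition.monotone (div_le_div_of_nonneg_right (by linarith) (by linarith))

/-- The cutoff does not have compact support, but its derivative vanishes off `[l, u]`, so every
higher derivative is continuous with compact support. -/
lemma isBoundedSmooth_cutoff {l u : ℝ} (h : l < u) : IsBoundedSmooth (cutoff l u) := by
  have hc : ContDiff ℝ (⊤ : ℕ∞) (cutoff l u) :=
    Real.smoothTransition.contDiff.comp ((contDiff_const.sub contDiff_id).div_const _)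
  refine ⟨hc, fun m => ?_⟩
  rcases m with _ | m
  · refine ⟨1, fun x => ?_⟩
    rw [norm_iteratedFDeriv_zero, Real.norm_of_nonneg (cutoff_nonneg _ _ _)]
    exact cutoff_le_one _ _ _
  · have hd : HasCompactSupport (fderiv ℝ (cutoff l u)) := by
      refine HasCompactSupport.intro (isCompact_Icc (a := l) (b := u)) fun x hx => ?_
      rw [Set.mem_Icc, not_and_or, not_le, not_le] at hx
      rcases hx with hx | hx
      · have : cutoff l u =ᶠ[nhds x] fun _ => 1 := by
          filter_upwards [Iio_mem_nhds hx] with y hy using cutoff_of_le h (le_of_lt hy)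
        rw [this.fderiv_eq]; simp
      · have : cutoff l u =ᶠ[nhds x] fun _ => 0 := by
          filter_upwards [Ioi_mem_nhds hx] with y hy using cutoff_of_ge h (le_of_lt hy)
        rw [this.fderiv_eq]; simp
    have hd' := hd.iteratedFDeriv (𝕜 := ℝ) m
    have hcont : Continuous (iteratedFDeriv ℝ m (fderiv ℝ (cutoff l u))) :=
      (hc.fderiv_right (m := (m : ℕ∞)) (by exact_mod_cast le_top)).continuous_iteratedFDeriv le_rfl
    obtain ⟨C, hC⟩ := hd'.exists_bound_of_continuous hcont
    exact ⟨C, fun x => by rw [← norm_iteratedFDeriv_fderiv]; exact hC x⟩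

lemma deriv_nonneg_of_forall_ge {g : ℝ → ℝ} {g' : ℝ} (hg : HasDerivAt g g' 0)
    (h : ∀ t, 0 ≤ t → g 0 ≤ g t) : 0 ≤ g' := by
  have h1 : Filter.Tendsto (slope g 0) (nhdsWithin 0 (Set.Ioi 0)) (nhds g') :=
    (hasDerivAt_iff_tendsto_slope.1 hg).mono_left
      (nhdsWithin_mono _ fun x hx => ne_of_gt hx)
  refine ge_of_tendsto h1 ?_
  filter_upwards [self_mem_nhdsWithin] with t ht
  rw [slope_def_field]
  exact div_nonneg (sub_nonneg.2 (h t (le_of_lt ht))) (by simpa using le_of_lt ht)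

/-- The q-increment of F grows when the base point moves along p. Differentiating at zero in t and
then in s preserves the sign. -/
lemma fderiv_fderiv_nonneg_of_supermodular {F : E → ℝ} (hF : ContDiff ℝ 2 F) (p q : E)
    (h : ∀ (x : E) (s t : ℝ), 0 ≤ s → 0 ≤ t → F (x + s • p) + F (x + t • q) ≤ F (x + s • p + t • q) + F x)
    (x : E) : 0 ≤ fderiv ℝ (fderiv ℝ F) x p q := by
  have hd : Differentiable ℝ F := hF.differentiable (by simp)
  have hdd : Differentiable ℝ (fderiv ℝ F) :=
    (hF.fderiv_right (m := 1) (by norm_num)).differentiable (by simp)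
  have hline : ∀ y v : E, HasDerivAt (fun t : ℝ => y + t • v) v 0 := fun y v => by
    simpa using ((hasDerivAt_id (0 : ℝ)).smul_const v).const_add y
  have h1 : HasDerivAt (fun s : ℝ => fderiv ℝ F (x + s • p)) (fderiv ℝ (fderiv ℝ F) x p) 0 := by
    refine HasFDerivAt.comp_hasDerivAt (0 : ℝ) ?_ (hline x p)
    simpa using (hdd x).hasFDerivAt
  have h2 : HasDerivAt (fun s : ℝ => fderiv ℝ F (x + s • p) q)
      (fderiv ℝ (fderiv ℝ F) x p q) 0 := by
    simpa using h1.clm_apply (hasDerivAt_const 0 q)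
  refine deriv_nonneg_of_forall_ge h2 fun s hs => ?_
  have hq : ∀ y : E, HasDerivAt (fun t : ℝ => F (y + t • q)) (fderiv ℝ F y q) 0 := fun y => by
    refine HasFDerivAt.comp_hasDerivAt (0 : ℝ) ?_ (hline y q)
    simpa using (hd y).hasFDerivAt
  have := deriv_nonneg_of_forall_ge ((hq (x + s • p)).sub (hq x)) fun t ht => by
    have := h x s t hs ht
    simp only [Pi.sub_apply, zero_smul, add_zero]
    linarith
  simpa using this

end BoundedSmooth

/-! ### Gordon's inequality for finite families. -/

section Gordon

variable {I J ι κ : Type*} [Fintype J] [Fintype ι] [Fintype κ]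

/-- A smooth approximation of the indicator of `∃ j, l (i, j) < x (i, j)`. -/
noncomputable def softRow (l u : I × J → ℝ) (i : I) (x : I × J → ℝ) : ℝ :=
  1 - ∏ j, cutoff (l (i, j)) (u (i, j)) (x (i, j))

variable {l u : I × J → ℝ}

lemma softRow_nonneg (i : I) (x : I × J → ℝ) : 0 ≤ softRow l u i x :=
  sub_nonneg.2 (Finset.prod_le_one (fun _ _ => cutoff_nonneg _ _ _) fun _ _ => cutoff_le_one _ _ _)

lemma softRow_le_one (i : I) (x : I × J → ℝ) : softRow l u i x ≤ 1 :=
  sub_le_self _ (Finset.prod_nonneg fun _ _ => cutoff_nonneg _ _ _)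

lemma softRow_mono (hlu : ∀ a, l a < u a) (i : I) : Monotone (softRow l u i) := fun _ _ hxy =>
  sub_le_sub_left (Finset.prod_le_prod (fun _ _ => cutoff_nonneg _ _ _) fun _ _ =>
    cutoff_antitone (hlu _) (hxy _)) _

variable [Fintype I]

/-- A smooth approximation of the indicator of `∀ i, ∃ j, l (i, j) < x (i, j)`. -/
noncomputable def softMinMax (l u x : I × J → ℝ) : ℝ := ∏ i, softRow l u i x

lemma softMinMax_nonneg (x : I × J → ℝ) : 0 ≤ softMinMax l u x :=
  Finset.prod_nonneg fun _ _ => softRow_nonneg _ _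

lemma softMinMax_le_one (x : I × J → ℝ) : softMinMax l u x ≤ 1 :=
  Finset.prod_le_one (fun _ _ => softRow_nonneg _ _) fun _ _ => softRow_le_one _ _

lemma softMinMax_eq_zero (hlu : ∀ a, l a < u a) {x : I × J → ℝ}
    (h : ∃ i, ∀ j, x (i, j) ≤ l (i, j)) : softMinMax l u x = 0 := by
  obtain ⟨i, hi⟩ := h
  refine Finset.prod_eq_zero (Finset.mem_univ i) ?_
  simp [softRow, cutoff_of_le (hlu _) (hi _)]

lemma softMinMax_eq_one (hlu : ∀ a, l a < u a) {x : I × J → ℝ}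
    (h : ¬ ∃ i, ∀ j, x (i, j) < u (i, j)) : softMinMax l u x = 1 := by
  push Not at h
  refine Finset.prod_eq_one fun i _ => ?_
  obtain ⟨j, hj⟩ := h i
  rw [softRow, Finset.prod_eq_zero (Finset.mem_univ j) (cutoff_of_ge (hlu _) hj), sub_zero]

lemma isBoundedSmooth_softMinMax (hlu : ∀ a, l a < u a) : IsBoundedSmooth (softMinMax l u) :=
  IsBoundedSmooth.prod _ fun i => (IsBoundedSmooth.const 1).sub <| IsBoundedSmooth.prod _ fun j =>
    (isBoundedSmooth_cutoff (hlu (i, j))).comp_clm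
      (ContinuousLinearMap.proj (R := ℝ) (φ := fun _ : I × J => ℝ) (i, j))

/-- Moving one entry changes only the factor of its row. For entries in different rows the mixed
increment is therefore the product of two row increments and the remaining factors, all nonnegative.
The argument fails within a row, which is why Gordon's inequality asks for equal covariances there.
-/
lemma softMinMax_supermodular [DecidableEq I] [DecidableEq J] (hlu : ∀ a, l a < u a)
    {a b : I × J} (hab : a.1 ≠ b.1) (x : I × J → ℝ) (s t : ℝ) (hs : 0 ≤ s) (ht : 0 ≤ t) :
    softMinMax l u (x + s • Pi.single a 1) + softMinMax l u (x + t • Pi.single b 1)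
      ≤ softMinMax l u (x + s • Pi.single a 1 + t • Pi.single b 1) + softMinMax l u x := by
  have hb : b.1 ∈ Finset.univ.erase a.1 := by simp [hab.symm]
  have hsplit : ∀ y, softMinMax l u y = softRow l u a.1 y * (softRow l u b.1 y *
      ∏ i ∈ (Finset.univ.erase a.1).erase b.1, softRow l u i y) := fun y => by
    rw [Finset.mul_prod_erase _ (fun i => softRow l u i y) hb,
      Finset.mul_prod_erase _ (fun i => softRow l u i y) (Finset.mem_univ _)]
    rfl
  have hind : ∀ (c : I × J) (i : I) (y : I × J → ℝ) (r : ℝ), i ≠ c.1 →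
      softRow l u i (y + r • Pi.single c 1) = softRow l u i y := by
    intro c i y r hi
    have : ∀ j, (i, j) ≠ c := fun j hj => hi (by rw [← hj])
    simp [softRow, this]
  have hrest : ∀ (c : I × J) (y : I × J → ℝ) (r : ℝ), c = a ∨ c = b →
      ∏ i ∈ (Finset.univ.erase a.1).erase b.1, softRow l u i (y + r • Pi.single c 1)
      = ∏ i ∈ (Finset.univ.erase a.1).erase b.1, softRow l u i y := by
    intro c y r hc
    refine Finset.prod_congr rfl fun i hi => hind c i y r ?_
    rw [Finset.mem_erase, Finset.mem_erase] at hi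
    rcases hc with rfl | rfl
    · exact hi.2.1
    · exact hi.1
  have hmono : ∀ (c : I × J) (y : I × J → ℝ) (r : ℝ), 0 ≤ r →
      softRow l u c.1 y ≤ softRow l u c.1 (y + r • Pi.single c 1) := by
    intro c y r hr
    refine softRow_mono hlu _ (le_add_of_nonneg_right ?_)
    exact smul_nonneg hr (Pi.single_nonneg.2 zero_le_one)
  rw [hsplit x, hsplit (x + s • _), hsplit (x + t • _), hsplit (x + s • _ + t • _),
    hrest b _ _ (Or.inr rfl), hrest b _ _ (Or.inr rfl), hrest a _ _ (Or.inl rfl),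
    hind b a.1 _ _ hab, hind b a.1 _ _ hab, hind a b.1 _ _ hab.symm]
  have e : softRow l u b.1 (x + s • Pi.single a 1 + t • Pi.single b 1)
      = softRow l u b.1 (x + t • Pi.single b 1) := by
    rw [add_right_comm, hind a b.1 _ _ hab.symm]
  rw [e]
  have h1 := sub_nonneg.2 (hmono a x s hs)
  have h2 := sub_nonneg.2 (hmono b x t ht)
  have h3 : 0 ≤ ∏ i ∈ (Finset.univ.erase a.1).erase b.1, softRow l u i x :=
    Finset.prod_nonneg fun _ _ => softRow_nonneg _ _
  have := mul_nonneg (mul_nonneg h1 h2) h3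
  linarith

lemma measurePreserving_comp_inl :
    MeasurePreserving (fun (z : ι ⊕ κ → ℝ) i => z (Sum.inl i)) (stdGauss (ι ⊕ κ))
      (stdGauss ι) := by
  have h := measurePreserving_sumPiEquivProdPi (X := fun _ : ι ⊕ κ => ℝ)
    (fun _ => gaussianReal 0 1)
  exact measurePreserving_fst.comp h

lemma measurePreserving_comp_inr :
    MeasurePreserving (fun (z : ι ⊕ κ → ℝ) i => z (Sum.inr i)) (stdGauss (ι ⊕ κ))
      (stdGauss κ) := by
  have h := measurePreserving_sumPiEquivProdPi (X := fun _ : ι ⊕ κ => ℝ)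
    (fun _ => gaussianReal 0 1)
  exact measurePreserving_snd.comp h

/-- **Gordon's comparison inequality** for finite families of centered Gaussian variables. -/
theorem gordon_comparison [DecidableEq ι] [DecidableEq κ]
    (X : (ι → ℝ) →L[ℝ] (I × J → ℝ)) (Y : (κ → ℝ) →L[ℝ] (I × J → ℝ))
    (hle : ∀ a b, ∑ c, Y (Pi.single c 1) a * Y (Pi.single c 1) b
      ≤ ∑ c, X (Pi.single c 1) a * X (Pi.single c 1) b)
    (heq : ∀ a b : I × J, a.1 = b.1 → ∑ c, Y (Pi.single c 1) a * Y (Pi.single c 1) b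
      = ∑ c, X (Pi.single c 1) a * X (Pi.single c 1) b)
    (hlu : ∀ a, l a < u a) :
    (stdGauss ι).real {x | ∃ i, ∀ j, X x (i, j) ≤ l (i, j)}
      ≤ (stdGauss κ).real {y | ∃ i, ∀ j, Y y (i, j) < u (i, j)} := by
  classical
  have hF := isBoundedSmooth_softMinMax hlu
  have hcF := hF.contDiff.continuous
  -- Both families are lifted to one Gaussian space where they read disjoint coordinates, so they
  -- become uncorrelated while keeping their laws.
  let pl : (ι ⊕ κ → ℝ) →L[ℝ] (ι → ℝ) := ContinuousLinearMap.pi fun i =>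
    ContinuousLinearMap.proj (Sum.inl i)
  let pr : (ι ⊕ κ → ℝ) →L[ℝ] (κ → ℝ) := ContinuousLinearMap.pi fun i =>
    ContinuousLinearMap.proj (Sum.inr i)
  have hll : ∀ c : ι, pl (Pi.single (Sum.inl c) 1) = Pi.single c 1 := fun c => by
    ext i; simp [pl, Pi.single_apply]
  have hlr : ∀ c : κ, pl (Pi.single (Sum.inr c) 1) = 0 := fun c => by
    ext i; simp [pl]
  have hrr : ∀ c : κ, pr (Pi.single (Sum.inr c) 1) = Pi.single c 1 := fun c => by
    ext i; simp [pr, Pi.single_apply]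
  have hrl : ∀ c : ι, pr (Pi.single (Sum.inl c) 1) = 0 := fun c => by
    ext i; simp [pr]
  have hpos : ∀ (x : I × J → ℝ) (a b : I × J), a.1 ≠ b.1 → 0 ≤
      fderiv ℝ (fderiv ℝ (softMinMax l u)) x (Pi.single a 1) (Pi.single b 1) := fun x a b hab =>
    fderiv_fderiv_nonneg_of_supermodular (contDiff_infty.1 hF.contDiff 2) _ _
      (softMinMax_supermodular hlu hab) x
  have hX0 : ∀ c a, X (pl (Pi.single (Sum.inr c) 1)) a = 0 := fun c a => by simp [hlr]
  have hY0 : ∀ c a, Y (pr (Pi.single (Sum.inl c) 1)) a = 0 := fun c a => by simp [hrl]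
  have key : ∫ y, softMinMax l u (Y y) ∂(stdGauss κ) ≤ ∫ x, softMinMax l u (X x) ∂(stdGauss ι) := by
    have h := integral_comp_le_of_covariance (X.comp pl) (Y.comp pr) hF
      (fun a b => by
        rw [Fintype.sum_sum_type]
        simp only [ContinuousLinearMap.comp_apply, hX0, hY0, mul_zero, zero_mul,
          Finset.sum_const_zero, add_zero])
      (fun x a b => by
        rw [Fintype.sum_sum_type, Fintype.sum_sum_type]
        simp only [ContinuousLinearMap.comp_apply, hX0, hY0, mul_zero, hll, hrr,
          Finset.sum_const_zero, add_zero, zero_add]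
        by_cases hab : a.1 = b.1
        · rw [heq a b hab, sub_self, zero_mul]
        · exact mul_nonneg (sub_nonneg.2 (hle a b)) (hpos x a b hab))
    have e1 := measurePreserving_comp_inl (ι := ι) (κ := κ)
    have e2 := measurePreserving_comp_inr (ι := ι) (κ := κ)
    rw [← e1.map_eq, ← e2.map_eq, integral_map e1.measurable.aemeasurable,
      integral_map e2.measurable.aemeasurable]
    · exact h
    · exact (hcF.comp Y.continuous).aestronglyMeasurable
    · exact (hcF.comp X.continuous).aestronglyMeasurable
  have hintX : Integrable (fun x => softMinMax l u (X x)) (stdGauss ι) :=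
    Integrable.of_bound (hcF.comp X.continuous).aestronglyMeasurable 1 (ae_of_all _ fun x => by
      rw [Real.norm_of_nonneg (softMinMax_nonneg _)]; exact softMinMax_le_one _)
  have hintY : Integrable (fun x => softMinMax l u (Y x)) (stdGauss κ) :=
    Integrable.of_bound (hcF.comp Y.continuous).aestronglyMeasurable 1 (ae_of_all _ fun x => by
      rw [Real.norm_of_nonneg (softMinMax_nonneg _)]; exact softMinMax_le_one _)
  have hA : MeasurableSet {x : ι → ℝ | ∃ i, ∀ j, X x (i, j) ≤ l (i, j)} := by
    refine MeasurableSet.congr (s := ⋃ i, ⋂ j, {x : ι → ℝ | X x (i, j) ≤ l (i, j)}) ?_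
      (by ext; simp)
    exact MeasurableSet.iUnion fun i => MeasurableSet.iInter fun j =>
      (isClosed_le (by fun_prop) continuous_const).measurableSet
  have hB : MeasurableSet {y : κ → ℝ | ∃ i, ∀ j, Y y (i, j) < u (i, j)} := by
    refine MeasurableSet.congr (s := ⋃ i, ⋂ j, {y : κ → ℝ | Y y (i, j) < u (i, j)}) ?_
      (by ext; simp)
    exact MeasurableSet.iUnion fun i => MeasurableSet.iInter fun j =>
      (isOpen_lt (by fun_prop) continuous_const).measurableSet
  -- `1 - softMinMax` lies between the indicators of the events at thresholds l and u.
  have h1 : (stdGauss ι).real {x | ∃ i, ∀ j, X x (i, j) ≤ l (i, j)}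
      ≤ ∫ x, (1 - softMinMax l u (X x)) ∂(stdGauss ι) := by
    rw [← integral_indicator_one hA]
    refine integral_mono ((integrable_const 1).indicator hA) ((integrable_const 1).sub hintX)
      fun x => ?_
    by_cases hx : ∃ i, ∀ j, X x (i, j) ≤ l (i, j)
    · simp [Set.indicator, hx, softMinMax_eq_zero hlu hx]
    · simp [Set.indicator, hx, softMinMax_le_one]
  have h2 : ∫ y, (1 - softMinMax l u (Y y)) ∂(stdGauss κ)
      ≤ (stdGauss κ).real {y | ∃ i, ∀ j, Y y (i, j) < u (i, j)} := by
    rw [← integral_indicator_one hB]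
    refine integral_mono ((integrable_const 1).sub hintY) ((integrable_const 1).indicator hB)
      fun y => ?_
    by_cases hy : ∃ i, ∀ j, Y y (i, j) < u (i, j)
    · simp [Set.indicator, hy, softMinMax_nonneg]
    · simp [Set.indicator, hy, softMinMax_eq_one hlu hy]
  rw [integral_sub (integrable_const 1) hintX] at h1
  rw [integral_sub (integrable_const 1) hintY] at h2
  simp only [integral_const, probReal_univ, smul_eq_mul, mul_one] at h1 h2
  linarith

end Gordon


/-! ### Min-max values of continuous functions on compact sets. -/

section MinMax

variable {W V : Type*} {S : Set W} {T : Set V} {f : W → V → ℝ}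

lemma maxOver_le (hT' : T.Nonempty) {w : W} {t : ℝ} (h : ∀ v ∈ T, f w v ≤ t) :
    maxOver T f w ≤ t :=
  csSup_le (hT'.image _) (by rintro _ ⟨v, hv, rfl⟩; exact h v hv)

variable [TopologicalSpace W] [TopologicalSpace V]

lemma ContinuousOn.uncurry_left_apply (hf : ContinuousOn (Function.uncurry f) (S ×ˢ T)) {w : W}
    (hw : w ∈ S) : ContinuousOn (fun v => f w v) T :=
  hf.comp (f := fun v => (w, v)) (by fun_prop) fun _ hv => ⟨hw, hv⟩

lemma ContinuousOn.uncurry_right_apply (hf : ContinuousOn (Function.uncurry f) (S ×ˢ T)) {v : V}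
    (hv : v ∈ T) : ContinuousOn (fun w => f w v) S :=
  hf.comp (f := fun w => (w, v)) (by fun_prop) fun _ hw => ⟨hw, hv⟩

lemma le_maxOver (hT : IsCompact T) (hf : ContinuousOn (Function.uncurry f) (S ×ˢ T)) {w : W}
    (hw : w ∈ S) {v : V} (hv : v ∈ T) : f w v ≤ maxOver T f w :=
  le_csSup (hT.image_of_continuousOn (ContinuousOn.uncurry_left_apply hf hw)).bddAbove
    (Set.mem_image_of_mem _ hv)

lemma maxOver_lt_iff (hT : IsCompact T) (hT' : T.Nonempty)
    (hf : ContinuousOn (Function.uncurry f) (S ×ˢ T)) {w : W} (hw : w ∈ S) {t : ℝ} :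
    maxOver T f w < t ↔ ∀ v ∈ T, f w v < t := by
  constructor
  · exact fun h v hv => (le_maxOver hT hf hw hv).trans_lt h
  · intro h
    obtain ⟨v, hv, hmax⟩ := hT.exists_isMaxOn hT' (ContinuousOn.uncurry_left_apply hf hw)
    exact (maxOver_le hT' fun v' hv' => hmax hv').trans_lt (h v hv)

/-- Any fixed v gives a lower bound through the minimum of `f · v`. Without boundedness the real
`sInf` would take its default value 0. -/
lemma bddBelow_maxOver (hS : IsCompact S) (hT : IsCompact T) (hT' : T.Nonempty)
    (hf : ContinuousOn (Function.uncurry f) (S ×ˢ T)) : BddBelow (maxOver T f '' S) := by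
  obtain ⟨v, hv⟩ := hT'
  obtain ⟨m, hm⟩ := (hS.image_of_continuousOn (ContinuousOn.uncurry_right_apply hf hv)).bddBelow
  refine ⟨m, ?_⟩
  rintro _ ⟨w, hw, rfl⟩
  exact (hm (Set.mem_image_of_mem _ hw)).trans (le_maxOver hT hf hw hv)

lemma minMax_lt_iff (hS : IsCompact S) (hS' : S.Nonempty) (hT : IsCompact T) (hT' : T.Nonempty)
    (hf : ContinuousOn (Function.uncurry f) (S ×ˢ T)) {t : ℝ} :
    minMax S T f < t ↔ ∃ w ∈ S, ∀ v ∈ T, f w v < t := by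
  rw [minMax, csInf_lt_iff (bddBelow_maxOver hS hT hT' hf) (hS'.image _)]
  simp only [Set.exists_mem_image]
  exact exists_congr fun w => and_congr_right fun hw => maxOver_lt_iff hT hT' hf hw

/-- The sublevel sets of the min-max value of a continuous function only depend on its values on
countable dense sets. -/
lemma minMax_lt_iff_dense (hS : IsCompact S) (hS' : S.Nonempty) (hT : IsCompact T)
    (hT' : T.Nonempty) (hf : ContinuousOn (Function.uncurry f) (S ×ˢ T))
    {wD : ℕ → S} {vD : ℕ → T} (hw : DenseRange wD) (hv : DenseRange vD) {t : ℝ} :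
    minMax S T f < t ↔ ∃ m i : ℕ, ∀ j, f (wD i) (vD j) ≤ t - 1 / ((m : ℝ) + 1) := by
  have hf' : Continuous fun z : S × T => f z.1 z.2 :=
    hf.comp_continuous (f := fun z : S × T => ((z.1 : W), (z.2 : V))) (by fun_prop)
      fun z => ⟨z.1.2, z.2.2⟩
  have : CompactSpace T := isCompact_iff_compactSpace.1 hT
  constructor
  · intro h
    rw [minMax, csInf_lt_iff (bddBelow_maxOver hS hT hT' hf) (hS'.image _)] at h
    obtain ⟨_, ⟨w, hwS, rfl⟩, hlt⟩ := h
    obtain ⟨m, hm⟩ := exists_nat_one_div_lt (sub_pos.2 hlt)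
    -- Compactness of T makes the strict inequality persist near w uniformly in v. The slack `1 / (m
    -- + 1)` yields non-strict inequalities, which in the converse pass from the dense sequence to
    -- all of T.
    have hev : ∀ᶠ w' : S in nhds ⟨w, hwS⟩, ∀ v ∈ (Set.univ : Set T),
        f w' v < t - 1 / ((m : ℝ) + 1) := by
      refine isCompact_univ.eventually_forall_of_forall_eventually fun v _ => ?_
      refine (hf'.continuousAt (x := ((⟨w, hwS⟩ : S), v))).eventually_lt continuousAt_const ?_
      have := le_maxOver hT hf hwS v.2
      simp only
      linarith
    obtain ⟨i, hi⟩ := hw.mem_nhds hev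
    exact ⟨m, i, fun j => (hi (vD j) (Set.mem_univ _)).le⟩
  · rintro ⟨m, i, h⟩
    rw [minMax_lt_iff hS hS' hT hT' hf]
    refine ⟨wD i, (wD i).2, fun v hvT => ?_⟩
    have hle : ∀ v : T, f (wD i) v ≤ t - 1 / ((m : ℝ) + 1) := fun v =>
      hv.induction_on v (isClosed_le (hf'.comp (by fun_prop : Continuous fun v => (wD i, v)))
        continuous_const) h
    have := hle ⟨v, hvT⟩
    have : 0 < 1 / ((m : ℝ) + 1) := by positivity
    linarith

/-- Weak duality; the minimum of `f · v` over S is attained, so the inequality stays strict. -/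
lemma lt_minMax_of_exists (hS : IsCompact S) (hS' : S.Nonempty) (hT : IsCompact T)
    (hf : ContinuousOn (Function.uncurry f) (S ×ˢ T)) {t : ℝ}
    (h : ∃ v ∈ T, ∀ w ∈ S, t < f w v) : t < minMax S T f := by
  obtain ⟨v, hv, h⟩ := h
  obtain ⟨w, hw, hmin⟩ := hS.exists_isMinOn hS' (ContinuousOn.uncurry_right_apply hf hv)
  refine (h w hw).trans_le (le_csInf (hS'.image _) ?_)
  rintro _ ⟨w', hw', rfl⟩
  exact (hmin hw').trans (le_maxOver hT hf hw' hv)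

lemma measurableSet_minMax_lt {Ω : Type*} [MeasurableSpace Ω] [SecondCountableTopology W]
    [SecondCountableTopology V] (hS : IsCompact S) (hS' : S.Nonempty)
    (hT : IsCompact T) (hT' : T.Nonempty) {F : Ω → W → V → ℝ}
    (hF : ∀ x, ContinuousOn (Function.uncurry (F x)) (S ×ˢ T))
    (hm : ∀ w v, Measurable fun x => F x w v) (t : ℝ) :
    MeasurableSet {x | minMax S T (F x) < t} := by
  have := hS'.to_subtype
  have := hT'.to_subtype
  have : {x | minMax S T (F x) < t} = ⋃ m : ℕ, ⋃ i : ℕ, ⋂ j : ℕ,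
      {x | F x (TopologicalSpace.denseSeq S i) (TopologicalSpace.denseSeq T j)
        ≤ t - 1 / ((m : ℝ) + 1)} := by
    ext x
    simp only [Set.mem_ofPred_eq, Set.mem_iUnion, Set.mem_iInter]
    exact minMax_lt_iff_dense hS hS' hT hT' (hF x) (TopologicalSpace.denseRange_denseSeq S)
      (TopologicalSpace.denseRange_denseSeq T)
  rw [this]
  exact MeasurableSet.iUnion fun m => MeasurableSet.iUnion fun i => MeasurableSet.iInter fun j =>
    measurableSet_le (hm _ _) measurable_const

end MinMax

/-! ### Gordon's inequality on compact index sets. -/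

section LinearObjective

variable {W V ι κ : Type*} [Fintype ι] [Fintype κ]

/-- An objective depending linearly on `x`, up to the deterministic term `ψ`. -/
noncomputable def linObj (A : W → V → ι → ℝ) (ψ : W → V → ℝ) (x : ι → ℝ) (w : W) (v : V) : ℝ :=
  ∑ c, A w v c * x c + ψ w v

variable {A : W → V → ι → ℝ} {B : W → V → κ → ℝ} {ψ : W → V → ℝ}

lemma measurable_linObj (w : W) (v : V) : Measurable fun x => linObj A ψ x w v := by
  unfold linObj
  fun_prop

/-- The linear map with matrix `D`. -/
noncomputable def matrixCLM {n : Type*} [Fintype n] (D : n → ι → ℝ) : (ι → ℝ) →L[ℝ] (n → ℝ) :=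
  ContinuousLinearMap.pi fun a => ∑ c, D a c • ContinuousLinearMap.proj c

lemma matrixCLM_apply {n : Type*} [Fintype n] (D : n → ι → ℝ) (x : ι → ℝ) (a : n) :
    matrixCLM D x a = ∑ c, D a c * x c := by
  simp [matrixCLM]

lemma matrixCLM_single {n : Type*} [Fintype n] [DecidableEq ι] (D : n → ι → ℝ) (c : ι) (a : n) :
    matrixCLM D (Pi.single c 1) a = D a c := by
  simp [matrixCLM_apply, Pi.single_apply]

variable [TopologicalSpace W] [TopologicalSpace V] {S : Set W} {T : Set V}

lemma continuousOn_linObj (hψ : ContinuousOn (Function.uncurry ψ) (S ×ˢ T))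
    (hA : ∀ c, ContinuousOn (fun z : W × V => A z.1 z.2 c) (S ×ˢ T)) (x : ι → ℝ) :
    ContinuousOn (Function.uncurry (linObj A ψ x)) (S ×ˢ T) :=
  (continuousOn_finsetSum _ fun c _ => (hA c).mul continuousOn_const).add hψ

lemma measurableSet_minMax_linObj_lt [SecondCountableTopology W] [SecondCountableTopology V]
    (hS : IsCompact S) (hS' : S.Nonempty)
    (hT : IsCompact T) (hT' : T.Nonempty) (hψ : ContinuousOn (Function.uncurry ψ) (S ×ˢ T))
    (hA : ∀ c, ContinuousOn (fun z : W × V => A z.1 z.2 c) (S ×ˢ T)) (t : ℝ) :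
    MeasurableSet {x | minMax S T (linObj A ψ x) < t} :=
  measurableSet_minMax_lt hS hS' hT hT' (continuousOn_linObj hψ hA) measurable_linObj t

/-- **Gordon's comparison inequality** for continuous Gaussian processes on compact sets. -/
theorem gordon_comparison_compact [SecondCountableTopology W] [SecondCountableTopology V]
    (hS : IsCompact S) (hS' : S.Nonempty)
    (hT : IsCompact T) (hT' : T.Nonempty) (hψ : ContinuousOn (Function.uncurry ψ) (S ×ˢ T))
    (hA : ∀ c, ContinuousOn (fun z : W × V => A z.1 z.2 c) (S ×ˢ T))
    (hB : ∀ c, ContinuousOn (fun z : W × V => B z.1 z.2 c) (S ×ˢ T))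
    (hle : ∀ w v w' v', ∑ c, B w v c * B w' v' c ≤ ∑ c, A w v c * A w' v' c)
    (heq : ∀ w v v', ∑ c, B w v c * B w v' c = ∑ c, A w v c * A w v' c) (t : ℝ) :
    (stdGauss ι) {x | minMax S T (linObj A ψ x) < t}
      ≤ (stdGauss κ) {y | minMax S T (linObj B ψ y) < t} := by
  classical
  have := hS'.to_subtype
  have := hT'.to_subtype
  set wD : ℕ → S := TopologicalSpace.denseSeq S
  set vD : ℕ → T := TopologicalSpace.denseSeq T
  have hwD : DenseRange wD := TopologicalSpace.denseRange_denseSeq S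
  have hvD : DenseRange vD := TopologicalSpace.denseRange_denseSeq T
  have hone : ∀ m m' : ℕ, m < m' → t - 1 / ((m : ℝ) + 1) < t - 1 / ((m' : ℝ) + 1) := by
    intro m m' h
    have := one_div_lt_one_div_of_lt (by positivity : (0 : ℝ) < (m : ℝ) + 1)
      (by exact_mod_cast Nat.succ_lt_succ h : (m : ℝ) + 1 < (m' : ℝ) + 1)
    linarith
  -- The deterministic ψ is absorbed into the thresholds, and passing from m to m + 1 provides the
  -- strict gap between l and u.
  have hfin : ∀ m r s : ℕ,
      (stdGauss ι) {x | ∃ i : Fin r, ∀ j : Fin s,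
        linObj A ψ x (wD i) (vD j) ≤ t - 1 / ((m : ℝ) + 1)}
      ≤ (stdGauss κ) {y | ∃ i : Fin r, ∀ j : Fin s,
        linObj B ψ y (wD i) (vD j) < t - 1 / (((m + 1 : ℕ) : ℝ) + 1)} := by
    intro m r s
    have key := gordon_comparison
      (matrixCLM fun a : Fin r × Fin s => A (wD a.1) (vD a.2))
      (matrixCLM fun a : Fin r × Fin s => B (wD a.1) (vD a.2))
      (l := fun a : Fin r × Fin s => t - 1 / ((m : ℝ) + 1) - ψ (wD a.1) (vD a.2))
      (u := fun a : Fin r × Fin s => t - 1 / (((m + 1 : ℕ) : ℝ) + 1) - ψ (wD a.1) (vD a.2))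
      (fun a b => by simp only [matrixCLM_single]; exact hle _ _ _ _)
      (fun a b hab => by simp only [matrixCLM_single, hab]; exact heq _ _ _)
      (fun a => sub_lt_sub_right (hone m (m + 1) (Nat.lt_succ_self m)) _)
    have key' := (ENNReal.toReal_le_toReal (measure_ne_top _ _) (measure_ne_top _ _)).1 key
    simp only [matrixCLM_apply, le_sub_iff_add_le, lt_sub_iff_add_lt] at key'
    simp only [linObj, le_sub_iff_add_le, lt_sub_iff_add_lt]
    exact key'
  have hlim : ∀ m r : ℕ,
      (stdGauss ι) {x | ∃ i : Fin r, ∀ j, linObj A ψ x (wD i) (vD j) ≤ t - 1 / ((m : ℝ) + 1)}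
      ≤ (stdGauss κ) {y | minMax S T (linObj B ψ y) < t} := by
    intro m r
    let E : ℕ → Set (κ → ℝ) := fun s => {y | ∃ i : Fin r, ∀ j : Fin s,
      linObj B ψ y (wD i) (vD j) < t - 1 / (((m + 1 : ℕ) : ℝ) + 1)}
    have hE : ∀ s, MeasurableSet (E s) := fun s => by
      have : E s = ⋃ i : Fin r, ⋂ j : Fin s, {y | linObj B ψ y (wD i) (vD j)
          < t - 1 / (((m + 1 : ℕ) : ℝ) + 1)} := by
        ext; simp [E]
      rw [this]
      exact MeasurableSet.iUnion fun i => MeasurableSet.iInter fun j =>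
        measurableSet_lt (measurable_linObj _ _) measurable_const
    have hanti : Antitone E := fun s s' h y ⟨i, hi⟩ => ⟨i, fun j => hi ⟨j, j.2.trans_le h⟩⟩
    have hsub : ⋂ s, E s ⊆ {y | minMax S T (linObj B ψ y) < t} := by
      intro y hy
      rw [Set.mem_iInter] at hy
      rw [Set.mem_ofPred_eq, minMax_lt_iff_dense hS hS' hT hT' (continuousOn_linObj hψ hB y) hwD hvD]
      by_contra hcon
      push Not at hcon
      -- Only finitely many rows occur, so one column bound covers a violation in every row; hence s
      -- tends to infinity with r fixed.
      choose j hj using fun i : Fin r => hcon (m + 1) i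
      obtain ⟨i, hi⟩ := hy (Finset.univ.sup j + 1)
      exact absurd (hi ⟨j i, Nat.lt_succ_of_le (Finset.le_sup (Finset.mem_univ i))⟩)
        (not_lt.2 (hj i).le)
    refine le_trans ?_ (measure_mono hsub)
    rw [hanti.measure_iInter (fun s => (hE s).nullMeasurableSet) ⟨0, measure_ne_top _ _⟩]
    exact le_iInf fun s => (measure_mono fun _ hx => hx.imp fun _ hi j => hi j).trans (hfin m r s)
  -- One index m controls both the number of rows and the slack, making the union increasing.
  have hset : {x | minMax S T (linObj A ψ x) < t} = ⋃ m : ℕ, {x | ∃ i : Fin m, ∀ j,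
      linObj A ψ x (wD i) (vD j) ≤ t - 1 / ((m : ℝ) + 1)} := by
    ext x
    rw [Set.mem_ofPred_eq, minMax_lt_iff_dense hS hS' hT hT' (continuousOn_linObj hψ hA x) hwD hvD,
      Set.mem_iUnion]
    constructor
    · rintro ⟨m, i, h⟩
      refine ⟨max m i + 1, ⟨i, by omega⟩, fun j => (h j).trans (hone m _ (by omega)).le⟩
    · rintro ⟨m, i, h⟩
      exact ⟨m, i, h⟩
  have hmono : Monotone fun m : ℕ => {x | ∃ i : Fin m, ∀ j,
      linObj A ψ x (wD i) (vD j) ≤ t - 1 / ((m : ℝ) + 1)} := by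
    rintro m m' h x ⟨i, hi⟩
    refine ⟨⟨i, i.2.trans_le h⟩, fun j => (hi j).trans ?_⟩
    rcases h.eq_or_lt with rfl | h
    · exact le_rfl
    · exact (hone m m' h).le
  rw [hset, hmono.measure_iUnion]
  exact iSup_le fun m => hlim m m

end LinearObjective

/-! ### The lower-tail bound with several bilinear terms. -/

section GaussianMinMax

lemma half_le_gaussianReal_Iic : (2 : ENNReal)⁻¹ ≤ gaussianReal 0 1 (Set.Iic 0) := by
  have h1 : gaussianReal 0 1 (Set.Ici 0) = gaussianReal 0 1 (Set.Iic 0) := by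
    have h := gaussianReal_map_neg (μ := 0) (v := 1)
    rw [neg_zero] at h
    conv_rhs => rw [← h, Measure.map_apply measurable_neg measurableSet_Iic]
    congr 1
    ext x
    simp
  have h2 : 1 ≤ 2 * gaussianReal 0 1 (Set.Iic 0) := by
    calc (1 : ENNReal) = gaussianReal 0 1 (Set.Iic 0 ∪ Set.Ici 0) := by
          rw [Set.Iic_union_Ici, measure_univ]
      _ ≤ gaussianReal 0 1 (Set.Iic 0) + gaussianReal 0 1 (Set.Ici 0) := measure_union_le _ _
      _ = _ := by rw [h1, two_mul]
  rw [ENNReal.inv_le_iff_le_mul (by simp) (by simp)]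
  exact h2

variable {W V L : Type*} {p q : L → ℕ}
  (a : (l : L) → W → EuclideanSpace ℝ (Fin (p l)))
  (b : (l : L) → V → EuclideanSpace ℝ (Fin (q l)))

/-- The coefficients of the bilinear process `∑ₗ bₗ(v)ᵀ Xₗ aₗ(w)`. -/
def bilinCoeff (w : W) (v : V) : ((l : L) × (Fin (q l) × Fin (p l))) → ℝ :=
  fun c => b c.1 v c.2.1 * a c.1 w c.2.2

/-- The coefficients of `∑ₗ bₗ(v)ᵀ Xₗ aₗ(w) + ‖aₗ(w)‖ ‖bₗ(v)‖ γₗ`. -/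
noncomputable def bilinNormCoeff (w : W) (v : V) :
    ((l : L) × (Fin (q l) × Fin (p l))) ⊕ L → ℝ :=
  Sum.elim (bilinCoeff a b w v) fun l => ‖a l w‖ * ‖b l v‖

/-- The coefficients of `∑ₗ ‖bₗ(v)‖ gₗᵀ aₗ(w) + ‖aₗ(w)‖ hₗᵀ bₗ(v)`. -/
noncomputable def auxCoeff (w : W) (v : V) :
    ((l : L) × Fin (p l)) ⊕ ((l : L) × Fin (q l)) → ℝ :=
  Sum.elim (fun c => ‖b c.1 v‖ * a c.1 w c.2) fun c => ‖a c.1 w‖ * b c.1 v c.2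

section Continuity

variable [TopologicalSpace W] [TopologicalSpace V] {S : Set W} {T : Set V} {a b}

lemma continuousOn_euclidean_apply {X : Type*} [TopologicalSpace X] {n : ℕ}
    {f : X → EuclideanSpace ℝ (Fin n)} {s : Set X} (hf : ContinuousOn f s) (i : Fin n) :
    ContinuousOn (fun x => f x i) s :=
  (PiLp.continuous_apply 2 _ i).comp_continuousOn hf

lemma continuousOn_bilinCoeff (ha : ∀ l, ContinuousOn (a l) S) (hb : ∀ l, ContinuousOn (b l) T)
    (c) : ContinuousOn (fun z : W × V => bilinCoeff a b z.1 z.2 c) (S ×ˢ T) := by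
  have h1 : ContinuousOn (fun z : W × V => a c.1 z.1) (S ×ˢ T) :=
    (ha c.1).comp continuousOn_fst fun z hz => hz.1
  have h2 : ContinuousOn (fun z : W × V => b c.1 z.2) (S ×ˢ T) :=
    (hb c.1).comp continuousOn_snd fun z hz => hz.2
  exact (continuousOn_euclidean_apply h2 _).mul (continuousOn_euclidean_apply h1 _)

lemma continuousOn_bilinNormCoeff (ha : ∀ l, ContinuousOn (a l) S)
    (hb : ∀ l, ContinuousOn (b l) T) (c) :
    ContinuousOn (fun z : W × V => bilinNormCoeff a b z.1 z.2 c) (S ×ˢ T) := by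
  rcases c with c | l
  · exact continuousOn_bilinCoeff ha hb c
  · have h1 : ContinuousOn (fun z : W × V => a l z.1) (S ×ˢ T) :=
      (ha l).comp continuousOn_fst fun z hz => hz.1
    have h2 : ContinuousOn (fun z : W × V => b l z.2) (S ×ˢ T) :=
      (hb l).comp continuousOn_snd fun z hz => hz.2
    exact h1.norm.mul h2.norm

lemma continuousOn_auxCoeff (ha : ∀ l, ContinuousOn (a l) S) (hb : ∀ l, ContinuousOn (b l) T)
    (c) : ContinuousOn (fun z : W × V => auxCoeff a b z.1 z.2 c) (S ×ˢ T) := by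
  have h1 : ∀ l, ContinuousOn (fun z : W × V => a l z.1) (S ×ˢ T) := fun l =>
    (ha l).comp continuousOn_fst fun z hz => hz.1
  have h2 : ∀ l, ContinuousOn (fun z : W × V => b l z.2) (S ×ˢ T) := fun l =>
    (hb l).comp continuousOn_snd fun z hz => hz.2
  rcases c with c | c
  · exact (h2 c.1).norm.mul (continuousOn_euclidean_apply (h1 c.1) _)
  · exact (h1 c.1).norm.mul (continuousOn_euclidean_apply (h2 c.1) _)

end Continuity

variable [Fintype L]

lemma sum_bilinNormCoeff_mul (w w' : W) (v v' : V) :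
    ∑ c, bilinNormCoeff a b w v c * bilinNormCoeff a b w' v' c
      = ∑ l, (inner ℝ (b l v) (b l v') * inner ℝ (a l w) (a l w')
        + ‖a l w‖ * ‖b l v‖ * (‖a l w'‖ * ‖b l v'‖)) := by
  rw [Fintype.sum_sum_type, Fintype.sum_sigma, Finset.sum_add_distrib]
  congr 1
  refine Finset.sum_congr rfl fun l _ => ?_
  rw [Fintype.sum_prod_type, PiLp.inner_apply, PiLp.inner_apply, Finset.sum_mul_sum]
  refine Finset.sum_congr rfl fun i _ => Finset.sum_congr rfl fun j _ => ?_
  simp only [bilinNormCoeff, bilinCoeff, Sum.elim_inl, RCLike.inner_apply, conj_trivial]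
  ring

lemma sum_auxCoeff_mul (w w' : W) (v v' : V) :
    ∑ c, auxCoeff a b w v c * auxCoeff a b w' v' c
      = ∑ l, (‖b l v‖ * ‖b l v'‖ * inner ℝ (a l w) (a l w')
        + ‖a l w‖ * ‖a l w'‖ * inner ℝ (b l v) (b l v')) := by
  rw [Fintype.sum_sum_type, Fintype.sum_sigma, Fintype.sum_sigma, Finset.sum_add_distrib]
  congr 1
  all_goals
    refine Finset.sum_congr rfl fun l _ => ?_
    rw [PiLp.inner_apply, Finset.mul_sum]
    refine Finset.sum_congr rfl fun i _ => ?_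
    simp only [auxCoeff, Sum.elim_inl, Sum.elim_inr, RCLike.inner_apply, conj_trivial]
    ring

/-- The l-th term of the gap factors as `(‖a‖‖a'‖ - ⟨a, a'⟩) (‖b‖‖b'‖ - ⟨b, b'⟩)`, and
Cauchy–Schwarz applies to each factor. For w = w' the first factor is zero. -/
lemma sum_auxCoeff_mul_le (w w' : W) (v v' : V) :
    ∑ c, auxCoeff a b w v c * auxCoeff a b w' v' c
      ≤ ∑ c, bilinNormCoeff a b w v c * bilinNormCoeff a b w' v' c := by
  rw [sum_bilinNormCoeff_mul, sum_auxCoeff_mul]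
  refine Finset.sum_le_sum fun l _ => ?_
  have h := mul_nonneg (sub_nonneg.2 (real_inner_le_norm (a l w) (a l w')))
    (sub_nonneg.2 (real_inner_le_norm (b l v) (b l v')))
  linarith

lemma sum_auxCoeff_mul_eq (w : W) (v v' : V) :
    ∑ c, auxCoeff a b w v c * auxCoeff a b w v' c
      = ∑ c, bilinNormCoeff a b w v c * bilinNormCoeff a b w v' c := by
  rw [sum_bilinNormCoeff_mul, sum_auxCoeff_mul]
  refine Finset.sum_congr rfl fun l _ => ?_
  rw [real_inner_self_eq_norm_sq]
  ring

variable [TopologicalSpace W] [TopologicalSpace V] {S : Set W} {T : Set V} {ψ : W → V → ℝ}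
  {a b}

/-- The Gaussian min-max theorem with several bilinear terms. -/
theorem gaussian_minMax [SecondCountableTopology W] [SecondCountableTopology V]
    (hS : IsCompact S) (hS' : S.Nonempty)
    (hT : IsCompact T) (hT' : T.Nonempty) (hψ : ContinuousOn (Function.uncurry ψ) (S ×ˢ T))
    (ha : ∀ l, ContinuousOn (a l) S) (hb : ∀ l, ContinuousOn (b l) T) (t : ℝ) :
    (stdGauss _) {x | minMax S T (linObj (bilinCoeff a b) ψ x) < t}
      ≤ 2 ^ Fintype.card L * (stdGauss _) {y | minMax S T (linObj (auxCoeff a b) ψ y) < t} := by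
  have hG := gordon_comparison_compact hS hS' hT hT' hψ (continuousOn_bilinNormCoeff ha hb)
    (continuousOn_auxCoeff ha hb) (fun w v w' v' => sum_auxCoeff_mul_le a b w w' v v')
    (sum_auxCoeff_mul_eq a b) t
  have hsign : (2 : ENNReal)⁻¹ ^ Fintype.card L
      ≤ (stdGauss L) (Set.univ.pi fun _ => Set.Iic 0) := by
    rw [Measure.pi_pi]
    calc _ = ∏ _l : L, (2 : ENNReal)⁻¹ := by simp
      _ ≤ _ := Finset.prod_le_prod' fun _ _ => half_le_gaussianReal_Iic
  -- The extra normals are independent of the bilinear part. When all are nonpositive, the added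
  -- terms only lower the objective.
  have hprod : (stdGauss _) {x | minMax S T (linObj (bilinCoeff a b) ψ x) < t}
      * (stdGauss L) (Set.univ.pi fun _ => Set.Iic 0)
      ≤ (stdGauss _) {x | minMax S T (linObj (bilinNormCoeff a b) ψ x) < t} := by
    rw [← Measure.prod_prod, ← (measurePreserving_sumPiEquivProdPi
      (X := fun _ : ((l : L) × (Fin (q l) × Fin (p l))) ⊕ L => ℝ)
      (fun _ => gaussianReal 0 1)).measure_preimage_equiv]
    refine measure_mono fun z hz => ?_
    obtain ⟨h1, h2⟩ := hz
    rw [Set.mem_ofPred_eq, minMax_lt_iff hS hS' hT hT'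
      (continuousOn_linObj hψ (continuousOn_bilinCoeff ha hb) _)] at h1
    rw [Set.mem_ofPred_eq, minMax_lt_iff hS hS' hT hT'
      (continuousOn_linObj hψ (continuousOn_bilinNormCoeff ha hb) _)]
    obtain ⟨w, hw, h⟩ := h1
    refine ⟨w, hw, fun v hv => lt_of_le_of_lt ?_ (h v hv)⟩
    unfold linObj
    rw [Fintype.sum_sum_type]
    refine add_le_add_left (add_le_of_nonpos_right ?_) _
    refine Finset.sum_nonpos fun l _ => mul_nonpos_of_nonneg_of_nonpos ?_ (h2 l (Set.mem_univ l))
    exact mul_nonneg (norm_nonneg _) (norm_nonneg _)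
  have h2 : (2 : ENNReal) ^ Fintype.card L * 2⁻¹ ^ Fintype.card L = 1 := by
    rw [← mul_pow, ENNReal.mul_inv_cancel (by simp) (by simp), one_pow]
  calc (stdGauss _) {x | minMax S T (linObj (bilinCoeff a b) ψ x) < t}
      = 2 ^ Fintype.card L * ((stdGauss _) {x | minMax S T (linObj (bilinCoeff a b) ψ x) < t}
        * 2⁻¹ ^ Fintype.card L) := by rw [mul_left_comm, h2, mul_one]
    _ ≤ 2 ^ Fintype.card L * (stdGauss _) {y | minMax S T (linObj (auxCoeff a b) ψ y) < t} := by
      gcongr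
      exact (mul_le_mul_right hsign _).trans (hprod.trans hG)

end GaussianMinMax


/-! ### Laws of reindexed and negated Gaussian families. -/

section Laws

variable {Ω ι κ : Type*} [MeasurableSpace Ω] {μ : Measure Ω}

lemma IsIIDStdGaussian.hasLaw [Fintype ι] {X : ι → Ω → ℝ} (hX : IsIIDStdGaussian μ X) :
    HasLaw (fun ω i => X i ω) (stdGauss ι) μ :=
  hX.2.hasLaw_pi hX.1

lemma IsIIDStdGaussian.precomp {X : ι → Ω → ℝ} (hX : IsIIDStdGaussian μ X) {e : κ → ι}
    (he : Function.Injective e) : IsIIDStdGaussian μ (fun i => X (e i)) :=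
  ⟨fun i => hX.1 (e i), hX.2.precomp he⟩

lemma IsIIDStdGaussian.neg {X : ι → Ω → ℝ} (hX : IsIIDStdGaussian μ X) :
    IsIIDStdGaussian μ (fun i ω => -X i ω) := by
  refine ⟨fun i => ?_, ?_⟩
  · have := gaussianReal_neg (hX.1 i)
    rwa [neg_zero] at this
  · exact hX.2.comp (fun _ x => -x) fun _ => measurable_neg

lemma measureReal_add_le_one_of_disjoint [IsProbabilityMeasure μ] {s t : Set Ω}
    (ht : NullMeasurableSet t μ) (h : Disjoint s t) : μ.real s + μ.real t ≤ 1 := by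
  rw [← measureReal_union₀ ht h.aedisjoint]
  exact measureReal_le_one

end Laws

/-! ### Existence of minimizers and minimax duality. -/

section Minimax

variable {W V : Type*} [TopologicalSpace W] [TopologicalSpace V] {S : Set W} {T : Set V}
  {f : W → V → ℝ}

/-- A supremum of continuous functions is lower semicontinuous, so it attains its minimum on a
nonempty compact set. -/
lemma argminMax_nonempty (hS : IsCompact S) (hS' : S.Nonempty) (hT : IsCompact T)
    (hT' : T.Nonempty) (hf : ContinuousOn (Function.uncurry f) (S ×ˢ T)) :
    (argminMax S T f).Nonempty := by
  have hlsc : LowerSemicontinuousOn (maxOver T f) S := by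
    intro w hw y hy
    obtain ⟨_, ⟨v, hv, rfl⟩, hlt⟩ := exists_lt_of_lt_csSup (hT'.image _) hy
    have h1 := (ContinuousOn.uncurry_right_apply hf hv w hw).eventually_const_lt hlt
    filter_upwards [h1, self_mem_nhdsWithin] with w' h' hw'
    exact h'.trans_le (le_maxOver hT hf hw' hv)
  obtain ⟨w, hw, hmin⟩ := LowerSemicontinuousOn.exists_isMinOn hS' hS hlsc
  exact ⟨w, hw, hmin⟩

variable [AddCommGroup W] [Module ℝ W] [IsTopologicalAddGroup W] [ContinuousSMul ℝ W]
  [AddCommGroup V] [Module ℝ V] [IsTopologicalAddGroup V] [ContinuousSMul ℝ V]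

/-- The witness is the v-component of a saddle point (w, v) from Sion's theorem: the min-max value
is at most `max f w ·`, which is at most `f w' v` for every w'. -/
lemma exists_lt_of_lt_minMax (hS : IsCompact S) (hS' : S.Nonempty) (hS'' : Convex ℝ S)
    (hT : IsCompact T) (hT' : T.Nonempty) (hT'' : Convex ℝ T)
    (hf : ContinuousOn (Function.uncurry f) (S ×ˢ T)) (hcc : IsConvexConcaveOn S T f) {t : ℝ}
    (h : t < minMax S T f) : ∃ v ∈ T, ∀ w ∈ S, t < f w v := by
  obtain ⟨w, hw, v, hv, hsad⟩ := Sion.exists_isSaddlePointOn (f := f) hS' hS'' hS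
    (fun v hv => (ContinuousOn.uncurry_right_apply hf hv).lowerSemicontinuousOn)
    (fun v hv => (hcc.1 v hv).quasiconvexOn) hT'' hT' hT
    (fun w hw => (ContinuousOn.uncurry_left_apply hf hw).upperSemicontinuousOn)
    (fun w hw => (hcc.2 w hw).quasiconcaveOn)
  refine ⟨v, hv, fun w' hw' => h.trans_le ?_⟩
  refine (csInf_le (bddBelow_maxOver hS hT hT' hf) (Set.mem_image_of_mem _ hw)).trans ?_
  exact maxOver_le hT' fun v' hv' => hsad w' hw' v' hv'

end Minimax

/-! ### Both tails for the primary and auxiliary problems. -/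

section Objectives

variable {d k : ℕ} {n : Fin k → ℕ}
  {α : Fin k → EuclideanSpace ℝ (Fin d) → EuclideanSpace ℝ (Fin d)}
  {β : (l : Fin k) → EuclideanSpace ℝ (Fin (n l)) → EuclideanSpace ℝ (Fin (n l))}
  {ψ : EuclideanSpace ℝ (Fin d) → ((l : Fin k) → EuclideanSpace ℝ (Fin (n l))) → ℝ}

open Matrix

lemma IsAffine.map_combo {m : ℕ} {f : EuclideanSpace ℝ (Fin m) → EuclideanSpace ℝ (Fin m)}
    (hf : IsAffine f) (x y : EuclideanSpace ℝ (Fin m)) {s t : ℝ} (hst : s + t = 1) :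
    f (s • x + t • y) = s • f x + t • f y := by
  obtain ⟨A, a, h⟩ := hf
  simp only [h]
  have ha : a = s • a + t • a := by rw [← add_smul, hst, one_smul]
  conv_lhs => rw [ha]
  simp only [WithLp.ofLp_add, WithLp.ofLp_smul, mulVec_add, mulVec_smul, WithLp.toLp_add,
    WithLp.toLp_smul, smul_add]
  abel

lemma primaryObj_isConvexConcaveOn {S : Set (EuclideanSpace ℝ (Fin d))}
    {T : Set ((l : Fin k) → EuclideanSpace ℝ (Fin (n l)))}
    (hψ : IsConvexConcaveOn S T ψ) (hα : ∀ l, IsAffine (α l)) (hβ : ∀ l, IsAffine (β l))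
    (G : (l : Fin k) → Matrix (Fin (n l)) (Fin d) ℝ) :
    IsConvexConcaveOn S T (primaryObj α β ψ G) := by
  refine ⟨fun v hv => ⟨(hψ.1 v hv).1, fun x hx y hy s t hs ht hst => ?_⟩,
    fun w hw => ⟨(hψ.2 w hw).1, fun x hx y hy s t hs ht hst => ?_⟩⟩
  · have h := (hψ.1 v hv).2 hx hy hs ht hst
    simp only [primaryObj, (hα _).map_combo x y hst, WithLp.ofLp_add, WithLp.ofLp_smul,
      mulVec_add, mulVec_smul, dotProduct_add, dotProduct_smul, Finset.sum_add_distrib,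
      ← Finset.smul_sum, smul_add] at h ⊢
    linarith
  · have h := (hψ.2 w hw).2 hx hy hs ht hst
    simp only [primaryObj, Pi.add_apply, Pi.smul_apply, (hβ _).map_combo _ _ hst,
      WithLp.ofLp_add, WithLp.ofLp_smul, add_dotProduct, smul_dotProduct,
      Finset.sum_add_distrib, ← Finset.smul_sum, smul_add] at h ⊢
    linarith

lemma primaryObj_eq_linObj (G : (l : Fin k) → Matrix (Fin (n l)) (Fin d) ℝ) :
    primaryObj α β ψ G = linObj (bilinCoeff α fun l v => β l (v l)) ψ
      (fun c => G c.1 c.2.1 c.2.2) := by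
  ext w v
  simp only [primaryObj, linObj, bilinCoeff, Fintype.sum_sigma, Fintype.sum_prod_type,
    dotProduct, mulVec, Finset.mul_sum]
  congr 1
  refine Finset.sum_congr rfl fun l _ => Finset.sum_congr rfl fun i _ =>
    Finset.sum_congr rfl fun j _ => by ring

/-- Negation and exchange of players reproduce a problem of the same shape, driven by the matrices
`-Gₗᵀ`, which have the same law up to the swap of dimensions. -/
lemma neg_primaryObj_eq_linObj (G : (l : Fin k) → Matrix (Fin (n l)) (Fin d) ℝ) :
    (fun v w => -primaryObj α β ψ G w v) = linObj
      (bilinCoeff (fun l (v : (l : Fin k) → EuclideanSpace ℝ (Fin (n l))) => β l (v l)) α)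
      (fun v w => -ψ w v) (fun c => -G c.1 c.2.2 c.2.1) := by
  ext v w
  simp only [primaryObj, linObj, bilinCoeff, Fintype.sum_sigma, Fintype.sum_prod_type,
    dotProduct, mulVec, Finset.mul_sum, neg_add, mul_neg, Finset.sum_neg_distrib]
  congr 2
  refine Finset.sum_congr rfl fun l _ => ?_
  rw [Finset.sum_comm]
  exact Finset.sum_congr rfl fun i _ => Finset.sum_congr rfl fun j _ => by ring

lemma auxObj_eq_linObj (g : Fin k → Fin d → ℝ) (h : (l : Fin k) → Fin (n l) → ℝ) :
    auxObj α β ψ g h = linObj (auxCoeff α fun l v => β l (v l)) ψ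
      (Sum.elim (fun c => g c.1 c.2) fun c => h c.1 c.2) := by
  ext w v
  simp only [auxObj, linObj, auxCoeff, Fintype.sum_sum_type, Sum.elim_inl, Sum.elim_inr,
    Fintype.sum_sigma, Finset.sum_add_distrib, dotProduct, Finset.mul_sum]
  congr 2
  all_goals
    exact Finset.sum_congr rfl fun l _ => Finset.sum_congr rfl fun i _ => by ring

lemma neg_auxObj_eq_linObj (g : Fin k → Fin d → ℝ) (h : (l : Fin k) → Fin (n l) → ℝ) :
    (fun v w => -auxObj α β ψ g h w v) = linObj
      (auxCoeff (fun l (v : (l : Fin k) → EuclideanSpace ℝ (Fin (n l))) => β l (v l)) α)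
      (fun v w => -ψ w v) (Sum.elim (fun c => -h c.1 c.2) fun c => -g c.1 c.2) := by
  ext v w
  simp only [auxObj, linObj, auxCoeff, Fintype.sum_sum_type, Sum.elim_inl, Sum.elim_inr,
    Fintype.sum_sigma, Finset.sum_add_distrib, dotProduct, Finset.mul_sum, neg_add, mul_neg,
    Finset.sum_neg_distrib]
  congr 1
  rw [add_comm]
  congr 2
  all_goals
    exact Finset.sum_congr rfl fun l _ => Finset.sum_congr rfl fun i _ => by ring

variable {Ω : Type*} [MeasurableSpace Ω] {μ : Measure Ω}
  {S : Set (EuclideanSpace ℝ (Fin d))} {T : Set ((l : Fin k) → EuclideanSpace ℝ (Fin (n l)))}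
  {G : Ω → (l : Fin k) → Matrix (Fin (n l)) (Fin d) ℝ}
  {g : Ω → Fin k → Fin d → ℝ} {h : Ω → (l : Fin k) → Fin (n l) → ℝ}

lemma continuousOn_primaryObj (hψ : ContinuousOn (Function.uncurry ψ) (S ×ˢ T))
    (hα : ∀ l, Continuous (α l)) (hβ : ∀ l, Continuous (β l))
    (G : (l : Fin k) → Matrix (Fin (n l)) (Fin d) ℝ) :
    ContinuousOn (Function.uncurry (primaryObj α β ψ G)) (S ×ˢ T) := by
  rw [primaryObj_eq_linObj]
  exact continuousOn_linObj hψ (continuousOn_bilinCoeff (fun l => (hα l).continuousOn)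
    fun l => ((hβ l).comp (continuous_apply l)).continuousOn) _

lemma continuousOn_auxObj (hψ : ContinuousOn (Function.uncurry ψ) (S ×ˢ T))
    (hα : ∀ l, Continuous (α l)) (hβ : ∀ l, Continuous (β l))
    (g : Fin k → Fin d → ℝ) (h : (l : Fin k) → Fin (n l) → ℝ) :
    ContinuousOn (Function.uncurry (auxObj α β ψ g h)) (S ×ˢ T) := by
  rw [auxObj_eq_linObj]
  exact continuousOn_linObj hψ (continuousOn_auxCoeff (fun l => (hα l).continuousOn)
    fun l => ((hβ l).comp (continuous_apply l)).continuousOn) _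

lemma hasLaw_aux (hgh : IsIIDStdGaussian μ (Sum.elim (fun (p : Fin k × Fin d) ω => g ω p.1 p.2)
      (fun (p : (l : Fin k) × Fin (n l)) ω => h ω p.1 p.2))) :
    HasLaw (fun ω => (Sum.elim (fun c => g ω c.1 c.2) fun c => h ω c.1 c.2 :
      ((_ : Fin k) × Fin d) ⊕ ((l : Fin k) × Fin (n l)) → ℝ)) (stdGauss _) μ := by
  have he : Function.Injective (Sum.map (Equiv.sigmaEquivProd (Fin k) (Fin d)) id :
      ((_ : Fin k) × Fin d) ⊕ ((l : Fin k) × Fin (n l)) → _) :=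
    (Equiv.injective _).sumMap Function.injective_id
  convert (hgh.precomp he).hasLaw using 3 with ω c
  rcases c with c | c <;> rfl

lemma hasLaw_neg_aux
    (hgh : IsIIDStdGaussian μ (Sum.elim (fun (p : Fin k × Fin d) ω => g ω p.1 p.2)
      (fun (p : (l : Fin k) × Fin (n l)) ω => h ω p.1 p.2))) :
    HasLaw (fun ω => (Sum.elim (fun c => -h ω c.1 c.2) fun c => -g ω c.1 c.2 :
      ((l : Fin k) × Fin (n l)) ⊕ ((_ : Fin k) × Fin d) → ℝ)) (stdGauss _) μ := by
  have he : Function.Injective (Sum.swap ∘ Sum.map id (Equiv.sigmaEquivProd (Fin k) (Fin d)) :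
      ((l : Fin k) × Fin (n l)) ⊕ ((_ : Fin k) × Fin d) → _) :=
    (Equiv.sumComm _ _).injective.comp (Function.injective_id.sumMap (Equiv.injective _))
  convert (hgh.neg.precomp he).hasLaw using 3 with ω c
  rcases c with c | c <;> rfl

lemma hasLaw_neg_primary (hG : IsIIDStdGaussian μ
      (fun (p : (l : Fin k) × (Fin (n l) × Fin d)) ω => G ω p.1 p.2.1 p.2.2)) :
    HasLaw (fun ω => (fun c => -G ω c.1 c.2.2 c.2.1 : ((l : Fin k) × (Fin d × Fin (n l))) → ℝ))
      (stdGauss _) μ := by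
  have he : Function.Injective (Sigma.map id fun _ => Prod.swap :
      ((l : Fin k) × (Fin d × Fin (n l))) → (l : Fin k) × (Fin (n l) × Fin d)) :=
    Function.injective_id.sigma_map fun _ => Prod.swap_injective
  exact (hG.neg.precomp he).hasLaw

lemma aemeasurable_minMax_aux (hS : IsCompact S) (hS' : S.Nonempty) (hT : IsCompact T)
    (hT' : T.Nonempty) (hψ : ContinuousOn (Function.uncurry ψ) (S ×ˢ T))
    (hα : ∀ l, Continuous (α l)) (hβ : ∀ l, Continuous (β l))
    (hgh : IsIIDStdGaussian μ (Sum.elim (fun (p : Fin k × Fin d) ω => g ω p.1 p.2)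
      (fun (p : (l : Fin k) × Fin (n l)) ω => h ω p.1 p.2))) :
    AEMeasurable (fun ω => minMax S T (auxObj α β ψ (g ω) (h ω))) μ := by
  have hm : Measurable fun y => minMax S T
      (linObj (auxCoeff α fun l (v : (l : Fin k) → EuclideanSpace ℝ (Fin (n l))) => β l (v l))
        ψ y) :=
    measurable_of_Iio fun t => measurableSet_minMax_linObj_lt hS hS' hT hT' hψ
      (continuousOn_auxCoeff (fun l => (hα l).continuousOn)
        fun l => ((hβ l).comp (continuous_apply l)).continuousOn) t
  simp only [auxObj_eq_linObj]
  exact hm.comp_aemeasurable (hasLaw_aux hgh).aemeasurable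

lemma toReal_le_two_pow_mul {a b : ENNReal} {k : ℕ} (hb : b ≠ ⊤) (h : a ≤ 2 ^ k * b) :
    a.toReal ≤ 2 ^ k * b.toReal := by
  have := ENNReal.toReal_mono (ENNReal.mul_ne_top (by simp) hb) h
  simpa using this

theorem measureReal_minMax_primary_lt_le (hS : IsCompact S) (hS' : S.Nonempty) (hT : IsCompact T)
    (hT' : T.Nonempty) (hψ : ContinuousOn (Function.uncurry ψ) (S ×ˢ T))
    (hα : ∀ l, Continuous (α l)) (hβ : ∀ l, Continuous (β l))
    (hG : IsIIDStdGaussian μ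
      (fun (p : (l : Fin k) × (Fin (n l) × Fin d)) ω => G ω p.1 p.2.1 p.2.2))
    (hgh : IsIIDStdGaussian μ (Sum.elim (fun (p : Fin k × Fin d) ω => g ω p.1 p.2)
      (fun (p : (l : Fin k) × Fin (n l)) ω => h ω p.1 p.2))) (t : ℝ) :
    μ.real {ω | minMax S T (primaryObj α β ψ (G ω)) < t}
      ≤ 2 ^ k * μ.real {ω | minMax S T (auxObj α β ψ (g ω) (h ω)) < t} := by
  have ha : ∀ l, ContinuousOn (α l) S := fun l => (hα l).continuousOn
  have hb : ∀ l, ContinuousOn (fun v : (l : Fin k) → EuclideanSpace ℝ (Fin (n l)) =>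
    β l (v l)) T := fun l => ((hβ l).comp (continuous_apply l)).continuousOn
  simp only [primaryObj_eq_linObj, auxObj_eq_linObj]
  rw [hG.hasLaw.measureReal_eq (measurableSet_minMax_linObj_lt hS hS' hT hT' hψ
      (continuousOn_bilinCoeff ha hb) t),
    (hasLaw_aux hgh).measureReal_eq (measurableSet_minMax_linObj_lt hS hS' hT hT' hψ
      (continuousOn_auxCoeff ha hb) t)]
  have := gaussian_minMax hS hS' hT hT' hψ ha hb t
  rw [Fintype.card_fin] at this
  exact toReal_le_two_pow_mul (measure_ne_top _ _) this

variable [IsProbabilityMeasure μ]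

/-- Strong duality is used for the primary problem only. The auxiliary objective need not be
convex-concave, but there weak duality has the right direction. -/
theorem measureReal_lt_minMax_primary_le (hS : IsCompact S) (hS' : S.Nonempty)
    (hS'' : Convex ℝ S) (hT : IsCompact T) (hT' : T.Nonempty) (hT'' : Convex ℝ T)
    (hψ : ContinuousOn (Function.uncurry ψ) (S ×ˢ T))
    (hα : ∀ l, Continuous (α l)) (hβ : ∀ l, Continuous (β l))
    (hG : IsIIDStdGaussian μ
      (fun (p : (l : Fin k) × (Fin (n l) × Fin d)) ω => G ω p.1 p.2.1 p.2.2))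
    (hgh : IsIIDStdGaussian μ (Sum.elim (fun (p : Fin k × Fin d) ω => g ω p.1 p.2)
      (fun (p : (l : Fin k) × Fin (n l)) ω => h ω p.1 p.2)))
    (hcc : IsConvexConcaveOn S T ψ) (hα' : ∀ l, IsAffine (α l)) (hβ' : ∀ l, IsAffine (β l))
    (t : ℝ) :
    μ.real {ω | t < minMax S T (primaryObj α β ψ (G ω))}
      ≤ 2 ^ k * μ.real {ω | t < minMax S T (auxObj α β ψ (g ω) (h ω))} := by
  have ha : ∀ l, ContinuousOn (α l) S := fun l => (hα l).continuousOn
  have hb : ∀ l, ContinuousOn (fun v : (l : Fin k) → EuclideanSpace ℝ (Fin (n l)) =>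
    β l (v l)) T := fun l => ((hβ l).comp (continuous_apply l)).continuousOn
  have hψ' : ContinuousOn (Function.uncurry fun v w => -ψ w v) (T ×ˢ S) :=
    (hψ.comp (f := Prod.swap) continuous_swap.continuousOn fun z hz => ⟨hz.2, hz.1⟩).neg
  have h1 : {ω | t < minMax S T (primaryObj α β ψ (G ω))}
      ⊆ {ω | minMax T S (fun v w => -primaryObj α β ψ (G ω) w v) < -t} := by
    intro ω hω
    obtain ⟨v, hv, hlt⟩ := exists_lt_of_lt_minMax hS hS' hS'' hT hT' hT''
      (continuousOn_primaryObj hψ hα hβ (G ω)) (primaryObj_isConvexConcaveOn hcc hα' hβ' (G ω)) hω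
    have hc : ContinuousOn (Function.uncurry fun v w => -primaryObj α β ψ (G ω) w v) (T ×ˢ S) := by
      rw [neg_primaryObj_eq_linObj]
      exact continuousOn_linObj hψ' (continuousOn_bilinCoeff hb ha) _
    rw [Set.mem_ofPred_eq, minMax_lt_iff hT hT' hS hS' hc]
    exact ⟨v, hv, fun w hw => neg_lt_neg (hlt w hw)⟩
  have h2 : {ω | minMax T S (fun v w => -auxObj α β ψ (g ω) (h ω) w v) < -t}
      ⊆ {ω | t < minMax S T (auxObj α β ψ (g ω) (h ω))} := by
    intro ω hω
    have hc : ContinuousOn (Function.uncurry fun v w => -auxObj α β ψ (g ω) (h ω) w v)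
        (T ×ˢ S) := by
      rw [neg_auxObj_eq_linObj]
      exact continuousOn_linObj hψ' (continuousOn_auxCoeff hb ha) _
    rw [Set.mem_ofPred_eq, minMax_lt_iff hT hT' hS hS' hc] at hω
    obtain ⟨v, hv, hlt⟩ := hω
    exact lt_minMax_of_exists hS hS' hT (continuousOn_auxObj hψ hα hβ _ _)
      ⟨v, hv, fun w hw => neg_lt_neg_iff.1 (hlt w hw)⟩
  refine (measureReal_mono h1).trans (le_trans ?_
    (mul_le_mul_of_nonneg_left (measureReal_mono h2) (by positivity)))
  simp only [neg_primaryObj_eq_linObj, neg_auxObj_eq_linObj]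
  rw [(hasLaw_neg_primary hG).measureReal_eq (measurableSet_minMax_linObj_lt hT hT' hS hS' hψ'
      (continuousOn_bilinCoeff hb ha) (-t)),
    (hasLaw_neg_aux hgh).measureReal_eq (measurableSet_minMax_linObj_lt hT hT' hS hS' hψ'
      (continuousOn_auxCoeff hb ha) (-t))]
  have := gaussian_minMax hT hT' hS hS' hψ' hb ha (-t)
  rw [Fintype.card_fin] at this
  exact toReal_le_two_pow_mul (measure_ne_top _ _) this

end Objectives

end GCGMT

/-! ### Assembly of the three claims. -/

theorem theorem4
    {Ω : Type*} [MeasurableSpace Ω] (μ : Measure Ω) [IsProbabilityMeasure μ]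
    (d k : ℕ) (n : Fin k → ℕ)
    -- the compact convex constraint sets
    (Sw : Set (EuclideanSpace ℝ (Fin d)))
    (hSw_ne : Sw.Nonempty) (hSw_cpt : IsCompact Sw) (hSw_conv : Convex ℝ Sw)
    (Svl : (l : Fin k) → Set (EuclideanSpace ℝ (Fin (n l))))
    (hSv_ne : ∀ l, (Svl l).Nonempty) (hSv_cpt : ∀ l, IsCompact (Svl l))
    (hSv_conv : ∀ l, Convex ℝ (Svl l))
    (Sv : Set ((l : Fin k) → EuclideanSpace ℝ (Fin (n l)))) (hSv : Sv = Set.univ.pi Svl)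
    -- the continuous functions
    (ψ : EuclideanSpace ℝ (Fin d) → ((l : Fin k) → EuclideanSpace ℝ (Fin (n l))) → ℝ)
    (hψ : ContinuousOn (Function.uncurry ψ) (Sw ×ˢ Sv))
    (α : Fin k → EuclideanSpace ℝ (Fin d) → EuclideanSpace ℝ (Fin d))
    (hα : ∀ l, Continuous (α l))
    (β : (l : Fin k) → EuclideanSpace ℝ (Fin (n l)) → EuclideanSpace ℝ (Fin (n l)))
    (hβ : ∀ l, Continuous (β l))
    -- the Gaussian matrices `G` with all entries i.i.d. standard normal
    (G : Ω → (l : Fin k) → Matrix (Fin (n l)) (Fin d) ℝ)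
    (hG : GCGMT.IsIIDStdGaussian μ
      (fun (p : (l : Fin k) × (Fin (n l) × Fin d)) ω => G ω p.1 p.2.1 p.2.2))
    -- the Gaussian vectors `g`, `h` with all entries (of both) i.i.d. standard normal
    (g : Ω → Fin k → Fin d → ℝ) (h : Ω → (l : Fin k) → Fin (n l) → ℝ)
    (hgh : GCGMT.IsIIDStdGaussian μ
      (Sum.elim (fun (p : Fin k × Fin d) ω => g ω p.1 p.2)
        (fun (p : (l : Fin k) × Fin (n l)) ω => h ω p.1 p.2)))
    -- the optimal values with `w` ranging over `S`: primary and auxiliary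
    (Φ φ : Set (EuclideanSpace ℝ (Fin d)) → Ω → ℝ)
    (hΦ : ∀ S ω, Φ S ω = GCGMT.minMax S Sv (GCGMT.primaryObj α β ψ (G ω)))
    (hφ : ∀ S ω, φ S ω = GCGMT.minMax S Sv (GCGMT.auxObj α β ψ (g ω) (h ω))) :
    -- (1)
    (∀ t : ℝ, μ.real {ω | Φ Sw ω < t} ≤ 2 ^ k * μ.real {ω | φ Sw ω < t}) ∧
    (GCGMT.IsConvexConcaveOn Sw Sv ψ →
      (∀ l, GCGMT.IsAffine (α l)) → (∀ l, GCGMT.IsAffine (β l)) →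
      -- (2)
      (∀ η c : ℝ, 0 < η →
        μ.real {ω | η < |Φ Sw ω - c|} ≤ 2 ^ k * μ.real {ω | η < |φ Sw ω - c|}) ∧
      -- (3)
      (∀ S : Set (EuclideanSpace ℝ (Fin d)), (∃ U, IsOpen U ∧ S = Sw ∩ U) →
        ∀ ε δ φbar φbarc : ℝ, 0 < ε → 0 < δ →
          φbar + 3 * δ ≤ φbarc →
          1 - ε ≤ μ.real {ω | φ Sw ω < φbar + δ} →
          -- the minimum over the empty set is `+∞`, so nothing is asked when `Sw \ S = ∅`
          ((Sw \ S).Nonempty → 1 - ε ≤ μ.real {ω | φbarc - δ < φ (Sw \ S) ω}) →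
          1 - 2 ^ (k + 1) * ε ≤
            μ.real {ω | (GCGMT.argminMax Sw Sv (GCGMT.primaryObj α β ψ (G ω))).Nonempty ∧
              GCGMT.argminMax Sw Sv (GCGMT.primaryObj α β ψ (G ω)) ⊆ S})) := by
  have hSvc : IsCompact Sv := hSv ▸ isCompact_univ_pi hSv_cpt
  have hSvn : Sv.Nonempty := hSv ▸ Set.univ_pi_nonempty_iff.2 hSv_ne
  have hSvx : Convex ℝ Sv := hSv ▸ convex_pi fun l _ => hSv_conv l
  -- Convexity plays no role here, so the bound also covers the complement of S needed in (3).
  have hlt : ∀ S ⊆ Sw, IsCompact S → S.Nonempty → ∀ t,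
      μ.real {ω | Φ S ω < t} ≤ 2 ^ k * μ.real {ω | φ S ω < t} := by
    intro S hS hSc hSn t
    simp only [hΦ, hφ]
    exact GCGMT.measureReal_minMax_primary_lt_le hSc hSn hSvc hSvn
      (hψ.mono (Set.prod_mono_left hS)) hα hβ hG hgh t
  have hmeas : ∀ S ⊆ Sw, IsCompact S → S.Nonempty → AEMeasurable (φ S) μ := by
    intro S hS hSc hSn
    have : φ S = fun ω => GCGMT.minMax S Sv (GCGMT.auxObj α β ψ (g ω) (h ω)) := funext (hφ S)
    rw [this]
    exact GCGMT.aemeasurable_minMax_aux hSc hSn hSvc hSvn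
      (hψ.mono (Set.prod_mono_left hS)) hα hβ hgh
  have hmw := hmeas Sw subset_rfl hSw_cpt hSw_ne
  refine ⟨hlt Sw subset_rfl hSw_cpt hSw_ne, fun hcc hα' hβ' => ?_⟩
  have hgt : ∀ t, μ.real {ω | t < Φ Sw ω} ≤ 2 ^ k * μ.real {ω | t < φ Sw ω} := by
    intro t
    simp only [hΦ, hφ]
    exact GCGMT.measureReal_lt_minMax_primary_le hSw_cpt hSw_ne hSw_conv hSvc hSvn hSvx
      hψ hα hβ hG hgh hcc hα' hβ' t
  refine ⟨fun η c hη => ?_, ?_⟩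
  · have hsplit : ∀ f : Ω → ℝ, {ω | η < |f ω - c|} = {ω | f ω < c - η} ∪ {ω | c + η < f ω} := by
      intro f
      ext ω
      simp only [Set.mem_ofPred_eq, Set.mem_union, lt_abs]
      constructor
      · rintro (h | h)
        · right; linarith
        · left; linarith
      · rintro (h | h)
        · right; linarith
        · left; linarith
    -- On the auxiliary side the two tails must add up exactly, which needs measurability;
    -- subadditivity suffices for the primary one.
    rw [hsplit, hsplit, measureReal_union₀ (nullMeasurableSet_lt aemeasurable_const hmw)
      (Disjoint.aedisjoint ?_)]
    · rw [mul_add]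
      exact (measureReal_union_le _ _).trans
        (add_le_add (hlt Sw subset_rfl hSw_cpt hSw_ne _) (hgt _))
    · rw [Set.disjoint_left]
      intro ω h1 h2
      simp only [Set.mem_ofPred_eq] at h1 h2
      linarith
  · rintro S ⟨U, hU, rfl⟩ ε δ φbar φbarc hε hδ hgap h1 h2
    have hcont : ∀ ω, ContinuousOn (Function.uncurry (GCGMT.primaryObj α β ψ (G ω))) (Sw ×ˢ Sv) :=
      fun ω => GCGMT.continuousOn_primaryObj hψ hα hβ (G ω)
    have hne : ∀ ω, (GCGMT.argminMax Sw Sv (GCGMT.primaryObj α β ψ (G ω))).Nonempty := fun ω =>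
      GCGMT.argminMax_nonempty hSw_cpt hSw_ne hSvc hSvn (hcont ω)
    have hpow : 0 < (2 : ℝ) ^ k := by positivity
    -- Over the empty set the real `sInf` is 0 instead of `+∞`, so this case is separate; the event
    -- is then certain.
    rcases (Sw \ (Sw ∩ U)).eq_empty_or_nonempty with hemp | hnonemp
    · have : {ω | (GCGMT.argminMax Sw Sv (GCGMT.primaryObj α β ψ (G ω))).Nonempty ∧
          GCGMT.argminMax Sw Sv (GCGMT.primaryObj α β ψ (G ω)) ⊆ Sw ∩ U} = Set.univ :=
        Set.eq_univ_of_forall fun ω =>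
          ⟨hne ω, fun w hw => Set.sdiff_eq_empty.1 hemp hw.1⟩
      rw [this, probReal_univ]
      have : 0 ≤ (2 : ℝ) ^ (k + 1) * ε := by positivity
      linarith
    · have hsub : Sw \ (Sw ∩ U) ⊆ Sw := Set.sdiff_subset
      have hcpt : IsCompact (Sw \ (Sw ∩ U)) := by
        rw [Set.sdiff_self_inter]
        exact hSw_cpt.diff hU
      have hA : μ.real {ω | φbar + δ < φ Sw ω} ≤ ε := by
        have := GCGMT.measureReal_add_le_one_of_disjoint (μ := μ)
          (s := {ω | φ Sw ω < φbar + δ}) (t := {ω | φbar + δ < φ Sw ω})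
          (nullMeasurableSet_lt aemeasurable_const hmw)
          (Set.disjoint_left.2 fun ω (h1 : φ Sw ω < _) (h2 : _ < φ Sw ω) => lt_asymm h1 h2)
        linarith
      have hB : μ.real {ω | φ (Sw \ (Sw ∩ U)) ω < φbarc - δ} ≤ ε := by
        have := GCGMT.measureReal_add_le_one_of_disjoint (μ := μ)
          (s := {ω | φbarc - δ < φ (Sw \ (Sw ∩ U)) ω})
          (t := {ω | φ (Sw \ (Sw ∩ U)) ω < φbarc - δ})
          (nullMeasurableSet_lt (hmeas _ hsub hcpt hnonemp) aemeasurable_const)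
          (Set.disjoint_left.2 fun ω (h1 : _ < φ (Sw \ (Sw ∩ U)) ω)
            (h2 : φ (Sw \ (Sw ∩ U)) ω < _) => lt_asymm h1 h2)
        have := h2 hnonemp
        linarith
      -- A minimizer outside S gives `Φ (Sw \ S) ≤ Φ Sw`, impossible off the two bad events because
      -- `φbar + δ < φbarc - δ`. Covering the whole space avoids any measurability claim about the
      -- argmin event.
      have hcover : (Set.univ : Set Ω) ⊆
          {ω | (GCGMT.argminMax Sw Sv (GCGMT.primaryObj α β ψ (G ω))).Nonempty ∧
            GCGMT.argminMax Sw Sv (GCGMT.primaryObj α β ψ (G ω)) ⊆ Sw ∩ U} ∪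
          ({ω | φbar + δ < Φ Sw ω} ∪ {ω | Φ (Sw \ (Sw ∩ U)) ω < φbarc - δ}) := by
        intro ω _
        by_contra hω
        simp only [Set.mem_union, Set.mem_ofPred_eq, not_or, not_and, not_lt] at hω
        obtain ⟨hω1, hω2, hω3⟩ := hω
        obtain ⟨w, hw, hwU⟩ := Set.not_subset.1 (hω1 (hne ω))
        rw [hΦ] at hω2 hω3
        have e1 : GCGMT.maxOver Sv (GCGMT.primaryObj α β ψ (G ω)) w
            ≤ GCGMT.minMax Sw Sv (GCGMT.primaryObj α β ψ (G ω)) := by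
          refine le_csInf (hSw_ne.image _) ?_
          rintro _ ⟨w', hw', rfl⟩
          exact hw.2 hw'
        have e2 : GCGMT.minMax (Sw \ (Sw ∩ U)) Sv (GCGMT.primaryObj α β ψ (G ω))
            ≤ GCGMT.maxOver Sv (GCGMT.primaryObj α β ψ (G ω)) w :=
          csInf_le (GCGMT.bddBelow_maxOver hcpt hSvc hSvn
            ((hcont ω).mono (Set.prod_mono_left hsub))) (Set.mem_image_of_mem _ ⟨hw.1, hwU⟩)
        linarith
      have htot := (measureReal_mono (μ := μ) hcover).trans ((measureReal_union_le _ _).trans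
        (add_le_add_right (measureReal_union_le _ _) _))
      rw [probReal_univ] at htot
      have hA' := (hgt (φbar + δ)).trans (mul_le_mul_of_nonneg_left hA hpow.le)
      have hB' := (hlt _ hsub hcpt hnonemp (φbarc - δ)).trans
        (mul_le_mul_of_nonneg_left hB hpow.le)
      rw [pow_succ]
      linarith
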